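/- Let $Q=\mathbb{Q}$ or $Q=\mathbb{F}_p(t)$ for a prime $p$, and let $Q\subseteq K\subseteq L$ be global fields with $K$ and $L$ finite and separable over $Q$. In the function field case all closed points of the projective curve, including those above $t=\infty$, count as non-archimedean places. For a non-archimedean place $w$ of $L$ above a place $v$ of $K$ let $\mathfrak d_{L_w/K_v}\subseteq O_{K_v}$ be the relative discriminant (the ideal generated by the discriminants of all bases of $L_w/K_v$ contained in $O_{L_w}$), and let $N(\mathfrak d_{L_w/K_v})=\#(O_{K_v}/\mathfrak d_{L_w/K_v})$. The relative measure $\mu_{L/K}$ on the adele ring $\mathbb A_L$ is the restricted product of the Haar measures on the $L_w$ with $\mu(O_{L_w})=N(\mathfrak d_{L_w/K_v})^{-1/2}$ at the non-archimedean places, Lebesgue measure at the real places, and twice Lebesgue measure at the complex places. For an idele $\alpha$ of $L$, with associated divisor $D_\alpha$, let $$f_\alpha(u)=\prod_{w\nmid\infty}\mathrm{char}_{O_{L_w}}(\alpha_w^{-1}u_w)\prod_{w\mid\infty}\exp\left(-e_w\pi\,|\alpha_w^{-1}u_w|_w^{2/e_w}\right),\qquad u\in\mathbb A_L,$$ where $w\mid\infty$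 means that $w$ is archimedean, $e_w=[L_w:\mathbb R]$, and $|\cdot|_w$ are the normalized absolute values (so $|x|_w=(\#k(w))^{-w(x)}$ at a non-archimedean $w$, and $|x|_w$ is the $e_w$-th power of the usual absolute value at an archimedean $w$). Write $|\alpha|=\prod_w|\alpha_w|_w$ and define $$\chi_{L/K}(D_\alpha)=\log\int_{\mathbb A_L}f_\alpha\,d\mu_{L/K},\qquad \chi_L=\chi_{L/Q},\qquad \chi_K=\chi_{K/Q}.$$ Let $\kappa_{L/K}$ be any idele of $K$ associated to the divisor of the global relative discriminant $\mathfrak d_{L/K}$: its component at every non-archimedean $v$ generates $\mathfrak d_{L/K}O_{K_v}$, and its component at every archimedean $v$ has absolute value $1$. Then such ideles $\kappa_{L/K}$ exist, and for every idele $\alpha$ of $L$ the function $f_\alpha$ is integrable with positive integral, and $$\chi_{L/K}(D_\alpha)=\log|\alpha|+\tfrac12\log|\kappa_{L/K}|,$$ $$\chi_{L/K}(D_\alpha)=\chi_L(D_\alpha)-[L:K]\,\chi_K(D_{1,K}),$$ $$\chi_{L/K}(D_\alpha)-\chi_{L/K}(D_1)=\log|\alpha|,$$ where $D_1$ and $D_{1,K}$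 are the divisors of the trivial ideles of $L$ and $K$. -/

import Mathlib

open MeasureTheory NumberField IsDedekindDomain

noncomputable section

namespace AdelicRR

/-- A one-dimensional global field: a number field, or a finite separable extension of `𝔽_p(t)`. -/
class GlobalField (K : Type*) [Field K] : Prop where
  out : NumberField K ∨ ∃ (p : ℕ) (_ : Fact p.Prime) (_ : Algebra (RatFunc (ZMod p)) K),
    FiniteDimensional (RatFunc (ZMod p)) K ∧ Algebra.IsSeparable (RatFunc (ZMod p)) K

/-- The archimedean places are Mathlib's `InfinitePlace K`; a global field has finitely many of
them, and a function field has none. -/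
instance GlobalField.finite_infinitePlace (K : Type*) [Field K] [h : GlobalField K] :
    Finite (InfinitePlace K) := by
  rcases h.out with h | ⟨p, hp, hA, -, -⟩
  · infer_instance
  · have hK : CharP (RatFunc (ZMod p)) p :=
      charP_of_injective_algebraMap (algebraMap (ZMod p) (RatFunc (ZMod p))).injective p
    have : CharP K p :=
      charP_of_injective_algebraMap (algebraMap (RatFunc (ZMod p)) K).injective p
    have : IsEmpty (InfinitePlace K) := by
      refine ⟨fun v => ?_⟩
      have h1 : CharP ℂ p := charP_of_injective_ringHom v.embedding.injective p
      exact hp.out.ne_zero (CharP.eq ℂ h1 (CharP.ofCharZero ℂ))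
    infer_instance

/-- A non-archimedean place of a global field, given by its valuation ring in the field: a discrete
valuation ring with finite residue field whose fraction field is `K`. This covers all the primes of
a number field, and all the closed points of the projective curve of a function field, including
those above `t = ∞`. (For a global field the residue field is automatically finite.) -/
@[ext]
structure FinPlace (K : Type*) [Field K] where
  ring : ValuationSubring K
  isDVR : IsDiscreteValuationRing ring
  finite_residueField : Finite (IsLocalRing.ResidueField ring)

namespace FinPlace

attribute [instance] FinPlace.isDVR FinPlace.finite_residueField

variable {K : Type*} [Field K]

/-- The maximal ideal of the valuation ring. -/
abbrev prime (v : FinPlace K) : HeightOneSpectrum v.ring :=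
  IsDiscreteValuationRing.maximalIdeal v.ring

/-- The completion `K_v`. -/
abbrev Completion (v : FinPlace K) : Type _ := v.prime.adicCompletion K

/-- The ring of integers `O_{K_v}` of the completion. -/
abbrev integers (v : FinPlace K) : ValuationSubring v.Completion :=
  v.prime.adicCompletionIntegers K

open scoped Classical in
/-- The normalized absolute value `|x|_v = (#k(v))^{-v(x)}` on `K_v`. -/
def absVal (v : FinPlace K) (x : v.Completion) : ℝ :=
  if x = 0 then 0
  else (Nat.card (IsLocalRing.ResidueField v.ring) : ℝ) ^ (WithZero.log (Valued.v x))

lemma isOpen_integers (v : FinPlace K) : IsOpen (v.integers : Set v.Completion) :=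
  Valued.isOpen_valuationSubring _

lemma mem_ring_iff (v : FinPlace K) (x : K) : x ∈ v.ring ↔ v.prime.valuation K x ≤ 1 := by
  refine ⟨fun h => v.prime.valuation_le_one (K := K) ⟨x, h⟩, fun h => ?_⟩
  obtain ⟨a, rfl⟩ := IsDiscreteValuationRing.exists_lift_of_le_one h
  exact a.2

lemma finite_residueField_integers (v : FinPlace K) :
    Finite (IsLocalRing.ResidueField v.integers) := by
  let f : v.ring →+* IsLocalRing.ResidueField v.integers :=
    (IsLocalRing.residue v.integers).comp (algebraMap v.ring v.integers)
  have hker : ∀ a ∈ IsLocalRing.maximalIdeal v.ring, f a = 0 := by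
    intro a ha
    rw [RingHom.comp_apply, IsLocalRing.residue_eq_zero_iff, IsLocalRing.mem_maximalIdeal,
      mem_nonunits_iff,
      HeightOneSpectrum.adicCompletionIntegers.isUnit_iff_valued_eq_one]
    have h1 : v.prime.valuation K (a : K) < 1 :=
      (v.prime.valuation_lt_one_iff_mem (K := K) a).mpr ha
    have h2 := HeightOneSpectrum.valuedAdicCompletion_eq_valuation' v.prime (a : K)
    intro h3
    exact h1.ne (h2.symm.trans h3)
  have : Finite (v.ring ⧸ IsLocalRing.maximalIdeal v.ring) := v.finite_residueField
  refine Finite.of_surjective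
    (Ideal.Quotient.lift (IsLocalRing.maximalIdeal v.ring) f hker :
      IsLocalRing.ResidueField v.ring → _) (Ideal.Quotient.lift_surjective_of_surjective _ hker ?_)
  intro y
  obtain ⟨y, rfl⟩ := IsLocalRing.residue_surjective y
  have hopen : IsOpen {z : v.Completion | Valued.v.restrict (z - y) < 1} :=
    (Valued.isOpen_ball v.Completion 1).preimage (continuous_id.sub continuous_const)
  obtain ⟨k, hk⟩ := (HeightOneSpectrum.denseRange_algebraMap K v.prime).exists_mem_open hopen
    ⟨(y : v.Completion), by simp⟩
  have hk' : Valued.v (algebraMap K v.Completion k - y) < 1 := by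
    simpa [Valuation.restrict_lt_iff_lt_embedding] using hk
  have hk1 : k ∈ v.ring := by
    rw [mem_ring_iff, ← HeightOneSpectrum.valuedAdicCompletion_eq_valuation' v.prime k]
    have h := Valued.v.map_add (algebraMap K v.Completion k - y) (y : v.Completion)
    rw [sub_add_cancel] at h
    exact h.trans (max_le hk'.le y.2)
  refine ⟨⟨k, hk1⟩, ?_⟩
  rw [RingHom.comp_apply, ← sub_eq_zero, ← map_sub, IsLocalRing.residue_eq_zero_iff,
    IsLocalRing.mem_maximalIdeal, mem_nonunits_iff,
    HeightOneSpectrum.adicCompletionIntegers.isUnit_iff_valued_eq_one]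
  exact hk'.ne

instance (v : FinPlace K) : CompactSpace v.integers := by
  have := v.finite_residueField_integers
  let _ : (Valued.v : Valuation v.Completion (WithZero (Multiplicative ℤ))).RankOne :=
    Valuation.IsRankOneDiscrete.rankOne _ (e := 2) (by norm_num)
  have h : CompactSpace (Valued.v : Valuation v.Completion
      (WithZero (Multiplicative ℤ))).integer := by
    rw [Valued.integer.compactSpace_iff_completeSpace_and_isDiscreteValuationRing_and_finite_residueField]
    refine ⟨?_, inferInstanceAs (IsDiscreteValuationRing v.integers),
      inferInstanceAs (Finite (IsLocalRing.ResidueField v.integers))⟩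
    exact (Valued.isClosed_integer v.Completion).completeSpace_coe
  exact h

/-- `O_{K_v}` as a compact set with non-empty interior. -/
def integersCompacts (v : FinPlace K) : TopologicalSpace.PositiveCompacts v.Completion where
  carrier := v.integers
  isCompact' := isCompact_iff_compactSpace.mpr (inferInstanceAs (CompactSpace v.integers))
  interior_nonempty' := by
    rw [v.isOpen_integers.interior_eq]
    exact ⟨0, zero_mem _⟩

instance (v : FinPlace K) : MeasurableSpace v.Completion := borel _
instance (v : FinPlace K) : BorelSpace v.Completion := ⟨rfl⟩

section Extension

variable (K) {L : Type*} [Field L] [Algebra K L]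

lemma finite_residueField_comap (w : FinPlace L) :
    Finite (IsLocalRing.ResidueField (w.ring.comap (algebraMap K L))) := by
  let f : w.ring.comap (algebraMap K L) →+* w.ring :=
    ((algebraMap K L).comp (w.ring.comap (algebraMap K L)).subtype).codRestrict w.ring
      (fun x => x.2)
  have hf : IsLocalHom f := by
    refine ⟨fun a ha => ?_⟩
    have ha0 : (a : K) ≠ 0 := by
      rintro h0
      have : a = 0 := Subtype.ext h0
      rw [this, map_zero] at ha
      exact not_isUnit_zero ha
    obtain ⟨b, hb⟩ := isUnit_iff_exists_inv.mp ha
    have hb' : algebraMap K L a * (b : L) = 1 := congrArg Subtype.val hb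
    have hinv : algebraMap K L (a : K)⁻¹ ∈ w.ring := by
      rw [map_inv₀, ← eq_inv_of_mul_eq_one_right hb']
      exact b.2
    exact isUnit_iff_exists_inv.mpr ⟨⟨(a : K)⁻¹, hinv⟩, Subtype.ext (mul_inv_cancel₀ ha0)⟩
  exact Finite.of_injective _ (IsLocalRing.ResidueField.map f).injective

variable [Algebra.IsAlgebraic K L]

lemma isDVR_comap (w : FinPlace L) :
    IsDiscreteValuationRing (w.ring.comap (algebraMap K L)) := by
  let u : Valuation K (WithZero (Multiplicative ℤ)) :=
    (w.prime.valuation L).comap (algebraMap K L)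
  have hu : u.valuationSubring = w.ring.comap (algebraMap K L) := by
    ext x
    rw [ValuationSubring.mem_comap, mem_ring_iff]
    rfl
  have hnt : u.IsNontrivial := by
    by_contra h
    have htop : w.ring.comap (algebraMap K L) = ⊤ := by
      rw [← hu]
      exact (Valuation.valuationSubring_eq_top_iff u).mpr h
    have hall : ∀ x : L, x ∈ w.ring := by
      intro x
      let g : K →+* w.ring := (algebraMap K L).codRestrict w.ring (fun k => by
        have : k ∈ w.ring.comap (algebraMap K L) := htop ▸ ValuationSubring.mem_top k
        exact this)
      obtain ⟨p, hp, hx⟩ := (Algebra.IsAlgebraic.isAlgebraic (R := K) x).isIntegral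
      have hint : IsIntegral w.ring x := ⟨p.map g, hp.map g, by
        rw [Polynomial.eval₂_map]
        exact hx⟩
      obtain ⟨y, rfl⟩ := IsIntegrallyClosed.isIntegral_iff.mp hint
      exact y.2
    refine IsDiscreteValuationRing.not_isField w.ring ?_
    refine ⟨⟨0, 1, zero_ne_one⟩, mul_comm, fun {a} ha => ?_⟩
    refine ⟨⟨(a : L)⁻¹, hall _⟩, Subtype.ext (mul_inv_cancel₀ ?_)⟩
    exact fun h => ha (Subtype.ext h)
  rw [← hu]
  have : Nontrivial (MonoidWithZeroHom.valueGroup (.ofClass u)) := inferInstance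
  infer_instance

/-- The place of `K` below a place `w` of `L`: its valuation ring is `O_w ∩ K`. -/
def below (w : FinPlace L) : FinPlace K where
  ring := w.ring.comap (algebraMap K L)
  isDVR := isDVR_comap K w
  finite_residueField := finite_residueField_comap K w

lemma continuous_toCompletion (w : FinPlace L) :
    Continuous (((algebraMap L w.Completion).comp (algebraMap K L)).comp
      (WithVal.equiv ((w.below K).prime.valuation K)).toRingHom) := by
  set φ := ((algebraMap L w.Completion).comp (algebraMap K L)).comp
      (WithVal.equiv ((w.below K).prime.valuation K)).toRingHom with hφ
  have hint : ∀ x : WithVal ((w.below K).prime.valuation K), Valued.v x ≤ 1 →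
      Valued.v (φ x) ≤ 1 := by
    intro x hx
    have h1 : WithVal.equiv _ x ∈ (w.below K).ring := ((w.below K).mem_ring_iff _).mpr hx
    have h2 : algebraMap K L (WithVal.equiv _ x) ∈ w.ring := h1
    have h3 := (w.mem_ring_iff _).mp h2
    rwa [← HeightOneSpectrum.valuedAdicCompletion_eq_valuation' w.prime] at h3
  obtain ⟨π, hπ⟩ := (w.below K).prime.valuation_exists_uniformizer K
  set ϖ := (WithVal.equiv ((w.below K).prime.valuation K)).symm π
  have hϖ : Valued.v ϖ = WithZero.exp (-1 : ℤ) := hπ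
  have hϖ0 : ϖ ≠ 0 := by
    intro h
    rw [h, map_zero] at hϖ
    exact WithZero.exp_ne_zero hϖ.symm
  have hφϖ : Valued.v (φ ϖ) < 1 := by
    refine lt_of_le_of_ne (hint ϖ (by rw [hϖ]; decide)) fun h => ?_
    have h1 : π⁻¹ ∈ (w.below K).ring := by
      change algebraMap K L π⁻¹ ∈ w.ring
      rw [mem_ring_iff, map_inv₀, map_inv₀]
      have h2 : w.prime.valuation L (algebraMap K L π) = 1 := by
        rw [← HeightOneSpectrum.valuedAdicCompletion_eq_valuation' w.prime]
        exact h
      rw [h2, inv_one]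
    rw [mem_ring_iff, map_inv₀, hπ] at h1
    exact absurd h1 (by decide)
  refine continuous_of_continuousAt_zero φ ?_
  rw [ContinuousAt, map_zero]
  intro U hU
  obtain ⟨γ, hγ⟩ := Valued.mem_nhds_zero.mp hU
  obtain ⟨N, hN⟩ : ∃ N : ℕ, Valued.v (φ ϖ) ^ N < MonoidWithZeroHom.ValueGroup₀.embedding γ.1 :=
    exists_pow_lt₀ hφϖ (Units.map (MonoidWithZeroHom.ValueGroup₀.embedding
      (f := .ofClass (Valued.v : Valuation w.Completion _))).toMonoidHom γ)
  have hball := Valued.isOpen_closedBall (WithVal ((w.below K).prime.valuation K))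
    (r := Valued.v.restrict (ϖ ^ N)) (by simp [hϖ0])
  have h0 : (0 : WithVal ((w.below K).prime.valuation K)) ∈
      {x | Valued.v.restrict x ≤ Valued.v.restrict (ϖ ^ N)} := by simp
  refine Filter.mem_map.mpr (Filter.mem_of_superset (hball.mem_nhds h0) fun x hx => hγ ?_)
  have hx' : Valued.v x ≤ Valued.v (ϖ ^ N) :=
    (Valuation.restrict_le_iff _).mp hx
  have hx1 : Valued.v (φ (x / ϖ ^ N)) ≤ 1 := by
    refine hint _ ?_
    rw [map_div₀]
    exact div_le_one_of_le₀ hx' zero_le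
  change Valued.v.restrict (φ x) < γ.1
  rw [Valuation.restrict_lt_iff_lt_embedding]
  refine lt_of_le_of_lt ?_ hN
  rw [← map_pow, ← map_pow, ← div_mul_cancel₀ x (pow_ne_zero N hϖ0), map_mul, map_mul]
  exact mul_le_of_le_one_left' hx1

/-- The embedding `K_v → L_w` of completions, for `w` above `v`, that extends `K → L` by
continuity. -/
def completionMap (w : FinPlace L) : (w.below K).Completion →+* w.Completion :=
  (UniformSpace.Completion.extensionHom _ (w.continuous_toCompletion K)).comp
    (HeightOneSpectrum.adicCompletion.equiv K (w.below K).prime).toRingHom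

end Extension

end FinPlace

/-- For `A` with fraction field `F`, a finite extension `E` of `F` and a set `B` of integral
elements of `E` (the integral closure of `A` in `E`): the ideal of `A` generated by the discriminants
of all the bases of `E` over `F` contained in `B`. -/
def discriminantIdeal (A : Type*) {F E : Type*} [CommRing A] [Field F] [Algebra A F] [Field E]
    [Algebra F E] (B : Set E) : Ideal A :=
  Ideal.span {a : A | ∃ b : Module.Basis (Fin (Module.finrank F E)) F E,
    (∀ i, b i ∈ B) ∧ algebraMap A F a = Algebra.discr F b}

/-- The absolute norm of an ideal: the cardinality of the quotient ring. -/
def idealNorm {A : Type*} [CommRing A] (I : Ideal A) : ℝ := Nat.card (A ⧸ I)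

section Relative

variable (K : Type*) [Field K] {L : Type*} [Field L] [Algebra K L] [Algebra.IsAlgebraic K L]

/-- The local relative discriminant `𝔡_{L_w/K_v}`, an ideal of `O_{K_v}`. -/
def localDiscriminant (w : FinPlace L) : Ideal (w.below K).integers :=
  letI : Algebra (w.below K).Completion w.Completion := (w.completionMap K).toAlgebra
  discriminantIdeal (w.below K).integers (F := (w.below K).Completion) (w.integers : Set w.Completion)

/-- The local relative measure at a non-archimedean place `w`: the Haar measure on `L_w` for which
`O_{L_w}` has measure `N(𝔡_{L_w/K_v})^{-1/2}`. -/
def localRelMeasure (w : FinPlace L) : Measure w.Completion :=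
  ENNReal.ofReal (idealNorm (localDiscriminant K w) ^ (-(1 / 2) : ℝ)) •
    Measure.addHaarMeasure w.integersCompacts

end Relative

section Archimedean

variable {K : Type*} [Field K]

instance (v : InfinitePlace K) : MeasurableSpace v.Completion := borel _
instance (v : InfinitePlace K) : BorelSpace v.Completion := ⟨rfl⟩

open scoped Classical in
/-- The measure at an archimedean place: Lebesgue measure if `K_v = ℝ`, twice Lebesgue measure
if `K_v = ℂ`. -/
def archMeasure (v : InfinitePlace K) : Measure v.Completion :=
  if h : v.IsReal then
    Measure.map (InfinitePlace.Completion.isometryEquivRealOfIsReal h).symm volume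
  else
    2 • Measure.map (InfinitePlace.Completion.isometryEquivComplexOfIsComplex
      (InfinitePlace.not_isReal_iff_isComplex.mp h)).symm volume

/-- The normalized absolute value `|x|_v = |x|^{e_v}` at an archimedean place, where
`e_v = [K_v : ℝ]`. -/
def archAbsVal (v : InfinitePlace K) (x : v.Completion) : ℝ := ‖x‖ ^ v.mult

end Archimedean

section Adeles

variable (K : Type*) [Field K]

/-- The ring of finite adeles: the restricted product of the `K_v` with respect to the `O_{K_v}`
over all the non-archimedean places. -/
abbrev FiniteAdele : Type _ :=
  RestrictedProduct (fun v : FinPlace K => v.Completion) (fun v => (v.integers : Set v.Completion))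
    Filter.cofinite

/-- The adele ring `𝔸_K`; for a function field the archimedean factor is trivial. -/
abbrev Adele : Type _ := InfiniteAdeleRing K × FiniteAdele K

instance : Fact (∀ v : FinPlace K, IsOpen (v.integers : Set v.Completion)) :=
  ⟨fun v => v.isOpen_integers⟩

instance : MeasurableSpace (FiniteAdele K) := borel _
instance : BorelSpace (FiniteAdele K) := ⟨rfl⟩

instance : MeasurableSpace (InfiniteAdeleRing K) :=
  inferInstanceAs (MeasurableSpace (∀ v : InfinitePlace K, v.Completion))

/-- The compact open subring `∏_v O_{K_v}` of the finite adeles. -/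
def integralFiniteAdeles : TopologicalSpace.PositiveCompacts (FiniteAdele K) where
  carrier := {x | ∀ v, x v ∈ v.integers}
  isCompact' := by
    rw [show {x : FiniteAdele K | ∀ v, x v ∈ v.integers} = Set.range
      (RestrictedProduct.structureMap (fun v : FinPlace K => v.Completion)
        (fun v => (v.integers : Set v.Completion)) Filter.cofinite) from
      (RestrictedProduct.range_structureMap ..).symm]
    have : ∀ v : FinPlace K, CompactSpace (v.integers : Set v.Completion) :=
      fun v => inferInstanceAs (CompactSpace v.integers)
    exact isCompact_range RestrictedProduct.isEmbedding_structureMap.continuous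
  interior_nonempty' := by
    have h : IsOpen {x : FiniteAdele K | ∀ v, x v ∈ v.integers} :=
      RestrictedProduct.isOpen_forall_mem (fun v => v.isOpen_integers)
    rw [h.interior_eq]
    exact ⟨0, fun v => zero_mem _⟩

/-- The measure on the archimedean part of the adeles: the product of the local measures. -/
def infiniteAdeleMeasure [GlobalField K] : Measure (InfiniteAdeleRing K) :=
  letI : Fintype (InfinitePlace K) := Fintype.ofFinite _
  Measure.pi (fun v : InfinitePlace K => archMeasure v)

end Adeles

section RelativeGlobal

variable (K L : Type*) [Field K] [Field L] [Algebra K L] [Algebra.IsAlgebraic K L]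

/-- The relative measure on the finite adeles of `L`: the restricted product of the local relative
measures, that is, the Haar measure for which `∏_w O_{L_w}` has measure `∏_w μ_w(O_{L_w})`. -/
def finiteRelMeasure : Measure (FiniteAdele L) :=
  (∏ᶠ w : FinPlace L, localRelMeasure K w (w.integers : Set w.Completion)) •
    Measure.addHaarMeasure (integralFiniteAdeles L)

/-- The relative measure `μ_{L/K}` on `𝔸_L`. -/
def relMeasure [GlobalField L] : Measure (Adele L) :=
  (infiniteAdeleMeasure L).prod (finiteRelMeasure K L)

end RelativeGlobal

section Euler

variable {L : Type*} [Field L]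

/-- The absolute value `|α| = ∏_w |α_w|_w` of an idele. -/
def ideleAbs (α : (Adele L)ˣ) : ℝ :=
  (∏ᶠ w : InfinitePlace L, archAbsVal w (α.val.1 w)) * ∏ᶠ w : FinPlace L, w.absVal (α.val.2 w)

/-- The local factor of `f_α` at a non-archimedean place, as a function of `x = α_w⁻¹ u_w`: the
characteristic function of `O_{L_w}`. -/
def finFactor (w : FinPlace L) (x : w.Completion) : ℝ :=
  (w.integers : Set w.Completion).indicator 1 x

/-- The local factor of `f_α` at an archimedean place, as a function of `x = α_w⁻¹ u_w`: the
Gaussian `exp(-e_w π |x|_w^{2/e_w})`. -/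
def archFactor (w : InfinitePlace L) (x : w.Completion) : ℝ :=
  Real.exp (-(w.mult * Real.pi * archAbsVal w x ^ (2 / w.mult : ℝ)))

/-- The function `f_α : 𝔸_L → ℝ` attached to an idele `α`. -/
def eulerFunction (α : (Adele L)ˣ) (u : Adele L) : ℝ :=
  (∏ᶠ w : InfinitePlace L, archFactor w ((α.val.1 w)⁻¹ * u.1 w)) *
    ∏ᶠ w : FinPlace L, finFactor w ((α.val.2 w)⁻¹ * u.2 w)

variable (K : Type*) [Field K] [Algebra K L] [Algebra.IsAlgebraic K L] [GlobalField L]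

/-- The relative Euler characteristic `χ_{L/K}(D_α) = log ∫ f_α dμ_{L/K}` of the divisor `D_α`
attached to an idele `α` of `L`. -/
def relEulerChar (α : (Adele L)ˣ) : ℝ :=
  Real.log (∫ u, eulerFunction α u ∂(relMeasure K L))

end Euler

section Discriminant

variable (K L : Type*) [Field K] [Field L] [Algebra K L]

/-- The stalk at `v` of the global relative discriminant `𝔡_{L/K}`: the discriminant over the
valuation ring of `v` in `K` of its integral closure in `L`. -/
def globalDiscriminantAt (v : FinPlace K) : Ideal v.ring :=
  discriminantIdeal v.ring (F := K)
    {x : L | ((algebraMap K L).comp (algebraMap v.ring K)).IsIntegralElem x}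

/-- `κ` is an idele of `K` associated to the divisor of the relative discriminant: `κ_v` generates
`𝔡_{L/K} O_{K_v}` for every non-archimedean `v`, and `|κ_v|_v = 1` for every archimedean `v`. -/
def IsDiscriminantIdele (κ : (Adele K)ˣ) : Prop :=
  (∀ v : InfinitePlace K, archAbsVal v (κ.val.1 v) = 1) ∧
  ∀ v : FinPlace K, ∃ x : v.integers, (x : v.Completion) = κ.val.2 v ∧
    Ideal.span {x} = (globalDiscriminantAt K L v).map (algebraMap v.ring v.integers)

end Discriminant

end AdelicRR

end

/-! The integral factors into local ones. A Gaussian at an archimedean place integrates to `|α_w|_w`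
for the chosen multiple of Lebesgue measure. At the finite places `f_α` is the characteristic
function of `α ∏ O_w`, whose volume is that of `∏ O_w` times the finite part of `|α|`. Hence `∫ f_α
= |α| · P(L/K)^(-1/2)`, where `P(L/K)` is the product over the places `w` of `L` of the norms of the
local discriminants (`integral_eulerFunction`, `relEulerChar_eq`). This gives integrability,
positivity and the third formula at once; the other two are statements about `P`.

For the first formula, `|κ| = P(L/K)⁻¹`. Over a finite place `v`, a basis of the integral closure of
`O_v` in `L` stays a basis of `∏_{w ∣ v} O_{L_w}` over `O_{K_v}` (`exists_isIntegralBasis_pi`). So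
does the union of bases of the factors, and two integral bases have discriminants differing by a
unit. Thus the discriminant at `v` is the product of the local ones
(`exists_globalDiscriminantAt_eq`). It is trivial at almost all `v`, which makes `P` a finite
product and lets its generators form an idele.

For the second formula, `P(L/Q) = P(L/K) · P(K/Q)^[L:K]` (`finprod_discNorm_tower`). Locally this is
the discriminant formula for towers. It needs that the normalized absolute value of `L_w` is that of
`K_v` composed with the norm (`Over.absVal_norm`), and globally that the local degrees above `v` add
up to `[L:K]`. -/

noncomputable section

namespace AdelicRR

/-! ### Integral bases and their discriminants. -/

section IntegralBasis

open Module Matrix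

variable {A F E ι κ : Type*} [CommRing A] [Field F] [Algebra A F] [CommRing E] [Algebra F E]

/-- `b` is an `F`-basis of `E` consisting of elements of `B`, in which all the elements of `B` have
coordinates in `A`. -/
structure IsIntegralBasis (A : Type*) {F E ι : Type*} [CommRing A] [Field F] [Algebra A F]
    [CommRing E] [Algebra F E] (B : Set E) (b : Basis ι F E) : Prop where
  mem : ∀ i, b i ∈ B
  repr_mem : ∀ x ∈ B, ∀ i, b.repr x i ∈ (algebraMap A F).range

namespace IsIntegralBasis

lemma reindex {B : Set E} {b : Basis ι F E} (h : IsIntegralBasis A B b) (e : ι ≃ κ) :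
    IsIntegralBasis A B (b.reindex e) where
  mem i := by simpa using h.mem _
  repr_mem x hx i := by simpa using h.repr_mem x hx _

variable [Fintype ι] [Fintype κ]

/-- Since `B` is a subring, multiplication by `x` sends each `b i` into `B`, so its matrix in the
basis `b` has entries in `A`. The same remark gives `norm_mem`. -/
lemma trace_mem {B : Subring E} {b : Basis ι F E} (h : IsIntegralBasis A (B : Set E) b) {x : E}
    (hx : x ∈ B) : Algebra.trace F E x ∈ (algebraMap A F).range := by
  classical
  rw [Algebra.trace_eq_matrix_trace b, Matrix.trace]
  refine sum_mem fun i _ => ?_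
  rw [diag_apply, Algebra.leftMulMatrix_eq_repr_mul]
  exact h.repr_mem _ (B.mul_mem hx (h.mem i)) i

lemma norm_mem {B : Subring E} {b : Basis ι F E} (h : IsIntegralBasis A (B : Set E) b) {x : E}
    (hx : x ∈ B) : Algebra.norm F x ∈ (algebraMap A F).range := by
  classical
  rw [Algebra.norm_eq_matrix_det b, Matrix.det_apply]
  refine sum_mem fun σ _ => ?_
  refine zsmul_mem (prod_mem fun i _ => ?_) _
  rw [Algebra.leftMulMatrix_eq_repr_mul]
  exact h.repr_mem _ (B.mul_mem hx (h.mem _)) _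

lemma discr_mem [DecidableEq ι] {B : Subring E} {b : Basis ι F E}
    (h : IsIntegralBasis A (B : Set E) b) : Algebra.discr F b ∈ (algebraMap A F).range := by
  rw [Algebra.discr_def, Matrix.det_apply]
  refine sum_mem fun σ _ => zsmul_mem (prod_mem fun i _ => ?_) _
  rw [Algebra.traceMatrix_apply, Algebra.traceForm_apply]
  exact h.trace_mem (B.mul_mem (h.mem _) (h.mem _))

/-- The matrix expressing `c` in terms of `b` has entries in `A`, and the discriminant changes by
the square of its determinant. -/
lemma exists_discr_eq [DecidableEq ι] {B : Set E} {b : Basis ι F E}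
    (h : IsIntegralBasis A B b) {c : ι → E} (hc : ∀ i, c i ∈ B) :
    ∃ a : A, Algebra.discr F c = algebraMap A F a ^ 2 * Algebra.discr F b := by
  have hP : (b : ι → E) ᵥ* (b.toMatrix c).map (algebraMap F E) = c := by
    ext j
    rw [Matrix.vecMul, dotProduct]
    simp_rw [Matrix.map_apply, mul_comm (b _), ← Algebra.smul_def]
    exact b.sum_toMatrix_smul_self c j
  choose f hf using fun i j => h.repr_mem (c j) (hc j) i
  refine ⟨(Matrix.of f).det, ?_⟩
  conv_lhs => rw [← hP, Algebra.discr_of_matrix_vecMul]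
  rw [RingHom.map_det]
  congr 3
  ext i j
  simp [hf, Basis.toMatrix_apply]

/-- Each basis is integral over the other. The two squared determinants multiply to `1`, because the
non-zero discriminant can be cancelled. -/
lemma exists_isUnit_discr_eq [DecidableEq ι] [DecidableEq κ] [FaithfulSMul A F] [IsDomain A]
    {B : Set E} {b : Basis ι F E} {c : Basis κ F E}
    (hb : IsIntegralBasis A B b) (hc : IsIntegralBasis A B c) (hne : Algebra.discr F b ≠ 0) :
    ∃ a : A, IsUnit a ∧ Algebra.discr F c = algebraMap A F a * Algebra.discr F b := by
  let e : κ ≃ ι := c.indexEquiv b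
  have h1 : Algebra.discr F c = Algebra.discr F (c.reindex e) := by
    rw [Basis.coe_reindex, Algebra.discr_reindex]
  obtain ⟨a, ha⟩ := hb.exists_discr_eq (hc.reindex e).mem
  obtain ⟨a', ha'⟩ := (hc.reindex e).exists_discr_eq hb.mem
  refine ⟨a ^ 2, ?_, by rw [h1, ha, map_pow]⟩
  refine IsUnit.of_mul_eq_one (a' ^ 2) ?_
  apply FaithfulSMul.algebraMap_injective A F
  rw [ha, ← mul_assoc, ← map_pow, ← map_pow, ← map_mul] at ha'
  rw [map_one, mul_comm (a ^ 2)]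
  exact (mul_eq_right₀ hne).mp ha'.symm

/-- Any basis inside `B` has discriminant a multiple of that of `b`, and `b` itself, indexed by
`Fin`, is one of the bases generating the ideal. -/
lemma discriminantIdeal_eq {E : Type*} [Field E] [Algebra F E] [DecidableEq ι] [FaithfulSMul A F]
    {B : Set E} {b : Basis ι F E} (h : IsIntegralBasis A B b) {d : A}
    (hd : algebraMap A F d = Algebra.discr F b) :
    discriminantIdeal A (F := F) B = Ideal.span {d} := by
  let e : ι ≃ Fin (finrank F E) :=
    (Fintype.equivFin ι).trans (finCongr (finrank_eq_card_basis b).symm)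
  have he : Algebra.discr F (b.reindex e) = Algebra.discr F b := by
    rw [Basis.coe_reindex, Algebra.discr_reindex]
  apply le_antisymm
  · rw [discriminantIdeal, Ideal.span_le]
    rintro a ⟨c, hc, hac⟩
    obtain ⟨r, hr⟩ := (h.reindex e).exists_discr_eq hc
    rw [he, ← hd, ← map_pow, ← map_mul] at hr
    have : a = r ^ 2 * d := FaithfulSMul.algebraMap_injective A F (hac.trans hr)
    rw [this]
    exact Ideal.mul_mem_left _ _ (Ideal.mem_span_singleton_self d)
  · rw [Ideal.span_singleton_le_iff_mem]
    exact Ideal.subset_span ⟨b.reindex e, (h.reindex e).mem, hd.trans he.symm⟩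

end IsIntegralBasis

/-- A lattice over a principal ideal domain has an integral basis. -/
lemma exists_isIntegralBasis {E : Type*} [CommRing E] [Algebra F E] [Algebra A E]
    [IsScalarTower A F E] [IsDomain A]
    [IsPrincipalIdealRing A] [IsFractionRing A F] (N : Submodule A E) (hfg : N.FG)
    (htop : Submodule.span F (N : Set E) = ⊤) :
    ∃ b : Basis (Fin (finrank F E)) F E, IsIntegralBasis A (N : Set E) b := by
  have : Submodule.IsLattice F N := ⟨hfg, htop⟩
  have hfree : Module.Free A N := Submodule.IsLattice.free F N
  let c := Module.Free.chooseBasis A N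
  let b := c.extendOfIsLattice F
  have h : IsIntegralBasis A (N : Set E) b := by
    refine ⟨fun i => ?_, fun x hx i => ?_⟩
    · rw [Basis.extendOfIsLattice_apply]
      exact (c i).2
    · have hx' : x = ∑ j, algebraMap A F (c.repr ⟨x, hx⟩ j) • b j := by
        have := congrArg (Subtype.val) (c.sum_repr ⟨x, hx⟩)
        rw [Submodule.coe_sum] at this
        simp only [b, Basis.extendOfIsLattice_apply, algebraMap_smul]
        exact this.symm
      rw [hx', b.repr_sum_self]
      exact ⟨_, rfl⟩
  let e := (Fintype.equivFin _).trans (finCongr (finrank_eq_card_basis b).symm)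
  exact ⟨b.reindex e, h.reindex e⟩

/-! ### Discriminants of finite products of algebras. -/

section Pi

variable {W : Type*} [Fintype W] [DecidableEq W] {E : W → Type*} [∀ w, CommRing (E w)]
  [∀ w, Algebra F (E w)] {κ : W → Type*} [∀ w, Fintype (κ w)] [∀ w, DecidableEq (κ w)]

lemma trace_pi (b : ∀ w, Basis (κ w) F (E w)) (x : ∀ w, E w) :
    Algebra.trace F (∀ w, E w) x = ∑ w, Algebra.trace F (E w) (x w) := by
  rw [Algebra.trace_eq_matrix_trace (Pi.basis b), Matrix.trace, Fintype.sum_sigma]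
  refine Finset.sum_congr rfl fun w _ => ?_
  rw [Algebra.trace_eq_matrix_trace (b w), Matrix.trace]
  refine Finset.sum_congr rfl fun i _ => ?_
  rw [diag_apply, diag_apply, Algebra.leftMulMatrix_eq_repr_mul, Algebra.leftMulMatrix_eq_repr_mul,
    Pi.basis_repr, Pi.basis_apply, Pi.mul_apply, Pi.single_eq_same]

/-- The blocks may have different sizes. An arbitrary linear order on `W` makes the matrix block
triangular. -/
lemma det_blockDiagonal_sigma {R : Type*} [CommRing R] (M : ∀ w, Matrix (κ w) (κ w) R) :
    (Matrix.blockDiagonal' M).det = ∏ w, (M w).det := by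
  let _ : LinearOrder W := LinearOrder.lift' (Fintype.equivFin W) (Fintype.equivFin W).injective
  have h : (Matrix.blockDiagonal' M).BlockTriangular Sigma.fst := by
    rintro ⟨w, i⟩ ⟨w', j⟩ hlt
    exact Matrix.blockDiagonal'_apply_ne M i j (ne_of_gt hlt)
  rw [h.det_fintype]
  refine Finset.prod_congr rfl fun w _ => ?_
  rw [← Matrix.det_reindex_self (Equiv.sigmaSubtype w)]
  congr 1
  ext i j
  simp [Matrix.toSquareBlock_def, Equiv.sigmaSubtype]

/-- Basis vectors from different factors multiply to zero, so the trace matrix is block diagonal. -/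
lemma discr_pi_basis (b : ∀ w, Basis (κ w) F (E w)) :
    Algebra.discr F (Pi.basis b) = ∏ w, Algebra.discr F (b w) := by
  simp_rw [Algebra.discr_def]
  rw [← det_blockDiagonal_sigma]
  congr 1
  ext ⟨w, i⟩ ⟨w', j⟩
  rw [Algebra.traceMatrix_apply, Algebra.traceForm_apply, trace_pi b, Pi.basis_apply,
    Pi.basis_apply, Matrix.blockDiagonal'_apply]
  split_ifs with h
  · obtain rfl : w = w' := h
    rw [Finset.sum_eq_single w]
    · simp [Algebra.traceMatrix_apply]
    · intro w' _ hw'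
      simp [hw'.symm]
    · simp
  · refine Finset.sum_eq_zero fun u _ => ?_
    rw [Pi.mul_apply]
    by_cases hu : u = w
    · subst hu
      rw [Pi.single_eq_of_ne (M := E) h, mul_zero, map_zero]
    · rw [Pi.single_eq_of_ne (M := E) hu, zero_mul, map_zero]

omit [∀ w, Fintype (κ w)] [∀ w, DecidableEq (κ w)] in
lemma IsIntegralBasis.pi {B : ∀ w, Set (E w)} {b : ∀ w, Basis (κ w) F (E w)}
    (hB : ∀ w, (0 : E w) ∈ B w) (h : ∀ w, IsIntegralBasis A (B w) (b w)) :
    IsIntegralBasis A (Set.univ.pi B) (Pi.basis b) where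
  mem := by
    rintro ⟨w, i⟩ w' -
    rw [Pi.basis_apply]
    by_cases hw : w' = w
    · subst hw
      rw [Pi.single_eq_same]
      exact (h _).mem i
    · rw [Pi.single_eq_of_ne (M := E) hw]
      exact hB w'
  repr_mem x hx := by
    rintro ⟨w, i⟩
    rw [Pi.basis_repr]
    exact (h w).repr_mem _ (hx w trivial) i

end Pi

/-- The discriminant of a basis is transported by a map which sends it to a basis. -/
lemma discr_map_basis {F' E' : Type*} [Field F'] [CommRing E'] [Algebra F' E'] [Fintype ι]
    [DecidableEq ι]
    (f : F →+* F') (g : E →+* E') (hfg : ∀ x, g (algebraMap F E x) = algebraMap F' E' (f x))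
    (b : Basis ι F E) (b' : Basis ι F' E') (hb : ∀ i, b' i = g (b i)) :
    Algebra.discr F' b' = f (Algebra.discr F b) := by
  -- Coordinates are compatible with `f` and `g`, hence so are multiplication matrices, traces and
  -- the trace form.
  have hrepr : ∀ x i, b'.repr (g x) i = f (b.repr x i) := by
    intro x i
    have : g x = ∑ j, f (b.repr x j) • b' j := by
      conv_lhs => rw [← b.sum_repr x, map_sum]
      refine Finset.sum_congr rfl fun j _ => ?_
      rw [Algebra.smul_def, map_mul, hfg, Algebra.smul_def, hb]
    rw [this, b'.repr_sum_self]
  have htr : ∀ x, Algebra.trace F' E' (g x) = f (Algebra.trace F E x) := by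
    intro x
    rw [Algebra.trace_eq_matrix_trace b', Algebra.trace_eq_matrix_trace b, Matrix.trace,
      Matrix.trace, map_sum]
    refine Finset.sum_congr rfl fun i _ => ?_
    rw [diag_apply, diag_apply, Algebra.leftMulMatrix_eq_repr_mul,
      Algebra.leftMulMatrix_eq_repr_mul, hb, ← map_mul, hrepr]
  rw [Algebra.discr_def, Algebra.discr_def, RingHom.map_det]
  congr 1
  ext i j
  simp [Algebra.traceMatrix_apply, Algebra.traceForm_apply, hb, ← map_mul, htr]

/-! ### Discriminants in a tower. -/

section Tower

variable {E M : Type*} [Field M] [Field E] [Algebra F E] [Algebra E M] [Algebra F M]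
  [IsScalarTower F E M] [Fintype ι] [DecidableEq ι] [Fintype κ] [DecidableEq κ]

/-- The discriminant of a tower of extensions. -/
lemma discr_smulTower' (b : Basis ι F E) (c : Basis κ E M) :
    Algebra.discr F (b.smulTower' c) =
      Algebra.discr F b ^ Fintype.card κ * Algebra.norm F (Algebra.discr E c) := by
  have hfin : FiniteDimensional F E := b.finiteDimensional_of_finite
  have hfin' : FiniteDimensional E M := c.finiteDimensional_of_finite
  -- By transitivity of the trace, the block at `(j, l)` is the trace matrix of `b` times the matrix
  -- of multiplication by `Tr(c j * c l)`. The latter matrices commute, so the determinant of the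
  -- array they form is the matrix determinant of multiplication by `discr c`, that is, its norm.
  have h : Algebra.traceMatrix F (b.smulTower' c) =
      Matrix.kronecker (1 : Matrix κ κ F) (Algebra.traceMatrix F b) *
        ((Algebra.traceMatrix E c).map (Algebra.leftMulMatrix b).toRingHom).comp κ κ ι ι F := by
    ext ⟨j, i⟩ ⟨l, k⟩
    rw [Matrix.mul_apply, Fintype.sum_prod_type, Finset.sum_eq_single j]
    · have h1 : Algebra.traceMatrix F (b.smulTower' c) (j, i) (l, k) =
          Algebra.trace F E (b i * (Algebra.trace E M (c j * c l) * b k)) := by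
        rw [Algebra.traceMatrix_apply, Algebra.traceForm_apply, Basis.smulTower'_apply,
          Basis.smulTower'_apply, ← Algebra.trace_trace (S := E), smul_mul_smul_comm, map_smul]
        congr 1
        simp only [smul_eq_mul]
        ring
      rw [h1]
      conv_lhs => rw [← b.sum_repr (Algebra.trace E M (c j * c l) * b k)]
      rw [Finset.mul_sum, map_sum]
      refine Finset.sum_congr rfl fun s _ => ?_
      rw [mul_smul_comm, map_smul, Matrix.kronecker, Matrix.kroneckerMap_apply,
        Matrix.one_apply_eq, one_mul, Algebra.traceMatrix_apply, Algebra.traceForm_apply,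
        smul_eq_mul, mul_comm]
      congr 1
      exact (Algebra.leftMulMatrix_eq_repr_mul b _ s k).symm
    · intro s _ hs
      refine Finset.sum_eq_zero fun k _ => ?_
      simp [hs.symm]
    · simp
  rw [Algebra.discr_def, h, Matrix.det_mul, Matrix.kronecker, Matrix.det_kronecker, ← Matrix.det_det,
    Algebra.norm_eq_matrix_det b, Algebra.discr_def, Algebra.discr_def]
  simp

omit [Fintype ι] [DecidableEq ι] [Fintype κ] [DecidableEq κ] in
lemma IsIntegralBasis.smulTower' {A' : Type*} [CommRing A'] [Algebra A' E] {B : Set E} {C : Set M}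
    {b : Basis ι F E} {c : Basis κ E M} (hb : IsIntegralBasis A B b)
    (hc : IsIntegralBasis A' C c) (hA' : ∀ x ∈ (algebraMap A' E).range, x ∈ B)
    (hC : ∀ x ∈ B, ∀ y ∈ C, x • y ∈ C) : IsIntegralBasis A C (b.smulTower' c) where
  mem i := by
    rw [Basis.smulTower'_apply]
    exact hC _ (hb.mem _) _ (hc.mem _)
  repr_mem x hx i := by
    rw [Basis.smulTower'_repr]
    exact hb.repr_mem _ (hA' _ (hc.repr_mem x hx _)) _

end Tower

end IntegralBasis

end AdelicRR

/-! ### The normalized absolute value of a completion. -/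

namespace AdelicRR

namespace FinPlace

variable {K : Type*} [Field K] (v : FinPlace K)

/-- The cardinality of the residue field. -/
abbrev residueCard : ℕ := Nat.card (IsLocalRing.ResidueField v.ring)

lemma one_lt_residueCard : 1 < v.residueCard := Finite.one_lt_card

@[simp] lemma absVal_zero : v.absVal 0 = 0 := by simp [absVal]

lemma absVal_of_ne_zero {x : v.Completion} (hx : x ≠ 0) :
    v.absVal x = (v.residueCard : ℝ) ^ (WithZero.log (Valued.v x)) := by simp [absVal, hx]

@[simp] lemma absVal_one : v.absVal 1 = 1 := by simp [absVal]

lemma absVal_pos {x : v.Completion} (hx : x ≠ 0) : 0 < v.absVal x := by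
  rw [v.absVal_of_ne_zero hx]
  have := v.one_lt_residueCard
  positivity

lemma absVal_nonneg (x : v.Completion) : 0 ≤ v.absVal x := by
  rcases eq_or_ne x 0 with rfl | hx
  · simp
  · exact (v.absVal_pos hx).le

lemma absVal_mul (x y : v.Completion) : v.absVal (x * y) = v.absVal x * v.absVal y := by
  rcases eq_or_ne x 0 with rfl | hx
  · simp
  rcases eq_or_ne y 0 with rfl | hy
  · simp
  have := v.one_lt_residueCard
  rw [v.absVal_of_ne_zero hx, v.absVal_of_ne_zero hy, v.absVal_of_ne_zero (mul_ne_zero hx hy),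
    map_mul, WithZero.log_mul (by simpa using hx) (by simpa using hy), zpow_add₀ (by positivity)]

/-- The normalized absolute value as a homomorphism. -/
def absValHom : v.Completion →*₀ ℝ where
  toFun := v.absVal
  map_zero' := v.absVal_zero
  map_one' := v.absVal_one
  map_mul' := v.absVal_mul

lemma absVal_prod {ι : Type*} (s : Finset ι) (f : ι → v.Completion) :
    v.absVal (∏ i ∈ s, f i) = ∏ i ∈ s, v.absVal (f i) := map_prod v.absValHom f s

lemma absVal_pow (x : v.Completion) (n : ℕ) : v.absVal (x ^ n) = v.absVal x ^ n :=
  map_pow v.absValHom x n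

lemma absVal_inv (x : v.Completion) : v.absVal x⁻¹ = (v.absVal x)⁻¹ :=
  map_inv₀ v.absValHom x

lemma absVal_congr {x y : v.Completion} (h : Valued.v x = Valued.v y) :
    v.absVal x = v.absVal y := by
  have h0 : x = 0 ↔ y = 0 := by
    rw [← Valuation.zero_iff (Valued.v : Valuation v.Completion _), h, Valuation.zero_iff]
  by_cases hx : x = 0
  · rw [hx, h0.mp hx]
  · rw [v.absVal_of_ne_zero hx, v.absVal_of_ne_zero (mt h0.mpr hx), h]

lemma absVal_eq_one_iff {x : v.Completion} : v.absVal x = 1 ↔ Valued.v x = 1 := by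
  refine ⟨fun h => ?_, fun h => ?_⟩
  · have hx : x ≠ 0 := by rintro rfl; simp at h
    have hx' : Valued.v x ≠ 0 := by simpa using hx
    rw [v.absVal_of_ne_zero hx] at h
    have hq : (1 : ℝ) < v.residueCard := by exact_mod_cast v.one_lt_residueCard
    rw [zpow_eq_one_iff_right₀ (by positivity) hq.ne'] at h
    rw [← WithZero.exp_log hx', h, WithZero.exp_zero]
  · have := v.absVal_congr (h.trans (map_one Valued.v).symm)
    rw [this, absVal_one]

lemma absVal_unit (a : v.integers) (ha : IsUnit a) : v.absVal a = 1 :=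
  v.absVal_eq_one_iff.mpr (HeightOneSpectrum.adicCompletionIntegers.isUnit_iff_valued_eq_one.mp ha)

lemma valued_algebraMap (x : K) :
    Valued.v (algebraMap K v.Completion x) = v.prime.valuation K x :=
  HeightOneSpectrum.valuedAdicCompletion_eq_valuation' v.prime x

lemma mem_integers_iff (x : v.Completion) : x ∈ v.integers ↔ Valued.v x ≤ 1 := Iff.rfl

lemma algebraMap_mem_integers_iff (x : K) :
    algebraMap K v.Completion x ∈ v.integers ↔ x ∈ v.ring := by
  rw [mem_integers_iff, valued_algebraMap, mem_ring_iff]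

lemma exists_uniformizer : ∃ π : K, v.prime.valuation K π = WithZero.exp (-1 : ℤ) :=
  v.prime.valuation_exists_uniformizer K

/-- A uniformizer, in the global field. -/
def unif : K := v.exists_uniformizer.choose

lemma valuation_unif : v.prime.valuation K v.unif = WithZero.exp (-1 : ℤ) :=
  v.exists_uniformizer.choose_spec

lemma valued_unif : Valued.v (algebraMap K v.Completion v.unif) = WithZero.exp (-1 : ℤ) := by
  rw [valued_algebraMap, valuation_unif]

lemma unif_ne_zero : v.unif ≠ 0 := by
  intro h
  have := v.valuation_unif
  rw [h, map_zero] at this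
  exact WithZero.exp_ne_zero this.symm

lemma unif_mem : v.unif ∈ v.ring := by
  rw [mem_ring_iff, valuation_unif]
  decide

lemma absVal_unif : v.absVal (algebraMap K v.Completion v.unif) = (v.residueCard : ℝ)⁻¹ := by
  rw [v.absVal_of_ne_zero (by simpa using v.unif_ne_zero), valued_unif, WithZero.log_exp,
    zpow_neg_one]

/-- Every non-zero element of the completion is a unit times a power of the uniformizer. -/
lemma exists_zpow_unif {x : v.Completion} (hx : x ≠ 0) :
    ∃ n : ℤ, Valued.v x = Valued.v (algebraMap K v.Completion v.unif ^ n) := by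
  refine ⟨-WithZero.log (Valued.v x), ?_⟩
  rw [map_zpow₀, valued_unif, ← WithZero.exp_zsmul]
  have hx' : Valued.v x ≠ 0 := by simpa using hx
  simp [WithZero.exp_log hx']

lemma exists_algebraMap_sub {y : v.Completion} {r : v.Completion} (hr : r ≠ 0) :
    ∃ k : K, Valued.v (y - algebraMap K v.Completion k) < Valued.v r := by
  have hopen : IsOpen {z : v.Completion | Valued.v.restrict (y - z) < Valued.v.restrict r} :=
    (Valued.isOpen_ball v.Completion (Valued.v.restrict r)).preimage
      (continuous_const.sub continuous_id)
  obtain ⟨k, hk⟩ := (HeightOneSpectrum.denseRange_algebraMap K v.prime).exists_mem_open hopen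
    ⟨y, by simpa [zero_lt_iff] using hr⟩
  exact ⟨k, (Valuation.restrict_lt_iff _).mp hk⟩

lemma exists_mem_ring_sub {y : v.Completion} (hy : y ∈ v.integers) {r : v.Completion} (hr : r ≠ 0)
    (hr1 : r ∈ v.integers) :
    ∃ k ∈ v.ring, Valued.v (y - algebraMap K v.Completion k) < Valued.v r := by
  obtain ⟨k, hk⟩ := v.exists_algebraMap_sub (y := y) hr
  refine ⟨k, ?_, hk⟩
  rw [← algebraMap_mem_integers_iff, ← sub_sub_cancel y (algebraMap K v.Completion k)]
  exact sub_mem hy (hk.le.trans hr1)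

/-- By density every integer of the completion is congruent, modulo the maximal ideal, to an element
of `v.ring`. -/
lemma card_residueField_integers :
    Nat.card (IsLocalRing.ResidueField v.integers) = v.residueCard := by
  have hloc : IsLocalHom (algebraMap v.ring v.integers) := by
    refine ⟨fun a ha => ?_⟩
    have h1 := HeightOneSpectrum.adicCompletionIntegers.isUnit_iff_valued_eq_one.mp ha
    have h2 : v.prime.valuation K (a : K) = 1 := by
      rw [← valued_algebraMap]
      exact h1
    have h3 : v.prime.valuation K (algebraMap v.ring K a) = 1 := h2
    rw [HeightOneSpectrum.valuation_eq_one_iff_notMem] at h3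
    exact (IsLocalRing.notMem_maximalIdeal).mp h3
  refine (Nat.card_congr (Equiv.ofBijective
    (IsLocalRing.ResidueField.map (algebraMap v.ring v.integers)) ⟨RingHom.injective _, ?_⟩)).symm
  intro y
  obtain ⟨y, rfl⟩ := IsLocalRing.residue_surjective y
  obtain ⟨k, hk, hk'⟩ := v.exists_mem_ring_sub y.2 one_ne_zero (one_mem _)
  refine ⟨IsLocalRing.residue _ ⟨k, hk⟩, ?_⟩
  rw [IsLocalRing.ResidueField.map_residue, eq_comm, ← sub_eq_zero, ← map_sub,
    IsLocalRing.residue_eq_zero_iff,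
    IsLocalRing.mem_maximalIdeal, mem_nonunits_iff,
    HeightOneSpectrum.adicCompletionIntegers.isUnit_iff_valued_eq_one]
  rw [map_one] at hk'
  exact hk'.ne

lemma maximalIdeal_integers : IsLocalRing.maximalIdeal v.integers =
    Ideal.span {⟨algebraMap K v.Completion v.unif,
      (v.algebraMap_mem_integers_iff _).mpr v.unif_mem⟩} := by
  ext x
  rw [IsLocalRing.mem_maximalIdeal, mem_nonunits_iff,
    HeightOneSpectrum.adicCompletionIntegers.isUnit_iff_valued_eq_one, Ideal.mem_span_singleton]
  have hu : algebraMap K v.Completion v.unif ≠ 0 := by simpa using v.unif_ne_zero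
  refine ⟨fun h => ?_, ?_⟩
  · have h1 : Valued.v (x : v.Completion) < 1 := lt_of_le_of_ne x.2 h
    have h2 : Valued.v ((x : v.Completion) / algebraMap K v.Completion v.unif) ≤ 1 := by
      rw [map_div₀, valued_unif]
      rcases eq_or_ne (Valued.v (x : v.Completion)) 0 with h0 | h0
      · simp [h0]
      rw [div_le_one₀ (by simp), ← WithZero.log_le_iff_le_exp h0]
      have : WithZero.log (Valued.v (x : v.Completion)) < 0 := by
        rwa [← WithZero.log_one, WithZero.log_lt_log h0 one_ne_zero]
      omega
    exact ⟨⟨_, h2⟩, Subtype.ext (mul_div_cancel₀ _ hu).symm⟩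
  · rintro ⟨y, rfl⟩
    refine ne_of_lt ?_
    change Valued.v (algebraMap K v.Completion v.unif * (y : v.Completion)) < 1
    rw [map_mul, valued_unif]
    exact mul_lt_one_of_lt_of_le (by decide) y.2

/-- Up to a unit `x` is the `n`-th power of the uniformizer, and `O_v` modulo the `n`-th power of
its maximal ideal has `(#k(v))^n` elements. -/
lemma natCard_quotient_span_singleton {x : v.integers} (hx : x ≠ 0) :
    (Nat.card (v.integers ⧸ Ideal.span {x}) : ℝ) = (v.absVal x)⁻¹ := by
  have hx0 : (x : v.Completion) ≠ 0 := fun h => hx (Subtype.ext h)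
  obtain ⟨n, hn⟩ := v.exists_zpow_unif hx0
  set u : v.integers := ⟨algebraMap K v.Completion v.unif,
      (v.algebraMap_mem_integers_iff _).mpr v.unif_mem⟩
  have hn0 : 0 ≤ n := by
    by_contra! h
    have h1 : Valued.v (x : v.Completion) ≤ 1 := x.2
    rw [hn, map_zpow₀, valued_unif, ← WithZero.exp_zsmul, ← WithZero.exp_zero,
      WithZero.exp_le_exp] at h1
    simp at h1
    omega
  lift n to ℕ using hn0
  rw [zpow_natCast] at hn
  have hspan : Ideal.span {x} = IsLocalRing.maximalIdeal v.integers ^ n := by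
    rw [v.maximalIdeal_integers, Ideal.span_singleton_pow, Ideal.span_singleton_eq_span_singleton]
    have hu0 : (algebraMap K v.Completion v.unif) ^ n ≠ 0 :=
      pow_ne_zero _ (by simpa using v.unif_ne_zero)
    have h1 : Valued.v (algebraMap K v.Completion v.unif ^ n / (x : v.Completion)) = 1 := by
      rw [map_div₀, ← hn, div_self (by simpa using hx0)]
    let w : v.integers := ⟨_, h1.le⟩
    have hw : IsUnit w :=
      HeightOneSpectrum.adicCompletionIntegers.isUnit_iff_valued_eq_one.mpr h1
    refine ⟨hw.unit, Subtype.ext ?_⟩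
    change (x : v.Completion) * (algebraMap K v.Completion v.unif ^ n / (x : v.Completion)) = _
    rw [mul_div_cancel₀ _ hx0]
    rfl
  have hcard : Nat.card (v.integers ⧸ Ideal.span {x}) = v.residueCard ^ n := by
    rw [hspan, ← card_residueField_integers, ← Submodule.cardQuot_apply,
      cardQuot_pow_of_prime (IsDiscreteValuationRing.not_a_field _), Submodule.cardQuot_apply]
    rfl
  rw [hcard, v.absVal_congr hn, absVal_pow, absVal_unif]
  simp

lemma idealNorm_span_singleton {x : v.integers} (hx : x ≠ 0) :
    idealNorm (Ideal.span {x}) = (v.absVal x)⁻¹ := v.natCard_quotient_span_singleton hx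

lemma isClosed_integers : IsClosed (v.integers : Set v.Completion) :=
  (isCompact_iff_compactSpace.mpr (inferInstanceAs (CompactSpace v.integers))).isClosed

/-- Valuation rings of places are maximal: an inclusion between them is an equality. -/
lemma eq_of_ring_le {v v' : FinPlace K} (h : v.ring ≤ v'.ring) : v = v' := by
  refine FinPlace.ext (le_antisymm h fun x hx => ?_)
  by_contra hxv
  rw [mem_ring_iff, not_le] at hxv
  refine IsDiscreteValuationRing.not_isField v'.ring ?_
  -- Powers of an `x` lying in `v'.ring` but not in `v.ring` have arbitrarily large value at `v`;
  -- dividing `y` by one of them lands in `v.ring`, which is contained in `v'.ring`.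
  have hall : ∀ y : K, y ∈ v'.ring := by
    intro y
    rcases eq_or_ne y 0 with rfl | hy
    · exact zero_mem _
    have hx0 : x ≠ 0 := by rintro rfl; simp at hxv
    have hy' : v.prime.valuation K y ≠ 0 := by simpa using hy
    have hinv : (v.prime.valuation K x)⁻¹ < 1 := inv_lt_one_of_one_lt₀ hxv
    obtain ⟨N, hN⟩ := exists_pow_lt₀ hinv (Units.mk0 _ (inv_ne_zero hy'))
    have : y / x ^ N ∈ v.ring := by
      rw [mem_ring_iff, map_div₀, map_pow]
      rw [Units.val_mk0, inv_pow, inv_lt_inv₀ (by simp [zero_lt_iff, hx0]) (by simp [zero_lt_iff, hy])] at hN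
      exact div_le_one_of_le₀ hN.le zero_le
    rw [← div_mul_cancel₀ y (pow_ne_zero N hx0)]
    exact mul_mem (h this) (pow_mem hx N)
  refine ⟨⟨0, 1, zero_ne_one⟩, mul_comm, fun {a} ha => ?_⟩
  exact ⟨⟨(a : K)⁻¹, hall _⟩, Subtype.ext (mul_inv_cancel₀ fun h => ha (Subtype.ext h))⟩

end FinPlace

end AdelicRR

/-! ### Places and maximal ideals of Dedekind domains; finiteness of poles. -/

namespace AdelicRR

namespace FinPlace

section Center

variable {R F : Type*} [CommRing R] [IsDedekindDomain R] [Field F] [Algebra R F]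
  [IsFractionRing R F]

lemma exists_notMem (w : FinPlace F) : ∃ x : F, x ∉ w.ring := by
  by_contra! h
  refine IsDiscreteValuationRing.not_isField w.ring ?_
  refine ⟨⟨0, 1, zero_ne_one⟩, mul_comm, fun {a} ha => ?_⟩
  exact ⟨⟨(a : F)⁻¹, h _⟩, Subtype.ext (mul_inv_cancel₀ fun h => ha (Subtype.ext h))⟩

/-- A place whose valuation ring contains a Dedekind domain `R` with fraction field `F` is given by
a maximal ideal of `R`. -/
lemma exists_heightOneSpectrum (w : FinPlace F) (hw : ∀ r : R, algebraMap R F r ∈ w.ring) :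
    ∃ P : HeightOneSpectrum R, ∀ x : F, x ∈ w.ring ↔ P.valuation F x ≤ 1 := by
  let f : R →+* w.ring := (algebraMap R F).codRestrict w.ring hw
  have hne : (IsLocalRing.maximalIdeal w.ring).comap f ≠ ⊥ := by
    intro hbot
    obtain ⟨x, hx⟩ := w.exists_notMem
    apply hx
    obtain ⟨a, b, hb, rfl⟩ := IsFractionRing.div_surjective (A := R) x
    have hb0 : b ≠ 0 := nonZeroDivisors.ne_zero hb
    have hu : IsUnit (f b) := by
      rw [← IsLocalRing.notMem_maximalIdeal]
      intro hmem
      have : b ∈ (IsLocalRing.maximalIdeal w.ring).comap f := hmem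
      rw [hbot] at this
      exact hb0 this
    obtain ⟨c, hc⟩ := hu.exists_right_inv
    have hc' : algebraMap R F b * (c : F) = 1 := congrArg Subtype.val hc
    rw [div_eq_mul_inv, ← eq_inv_of_mul_eq_one_right hc']
    exact mul_mem (hw a) c.2
  let P : HeightOneSpectrum R :=
    ⟨(IsLocalRing.maximalIdeal w.ring).comap f, Ideal.IsPrime.comap f, hne⟩
  -- The place dominates the localization at its center `P`. The latter is a discrete valuation
  -- ring, so it has no proper overring other than the field, and the two coincide.
  have hle : HeightOneSpectrum.valuationSubringAtPrime F P ≤ w.ring := by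
    intro x hx
    rw [HeightOneSpectrum.valuationSubringAtPrime_eq_valuationSubring] at hx
    obtain ⟨n, d, h⟩ := P.exists_primeCompl_mul_eq_of_integer x hx
    have hu : IsUnit (f d) := by
      rw [← IsLocalRing.notMem_maximalIdeal]
      exact d.2
    obtain ⟨c, hc⟩ := hu.exists_right_inv
    have hc' : algebraMap R F d * (c : F) = 1 := congrArg Subtype.val hc
    rw [← mul_one x, ← hc', ← mul_assoc, h]
    exact mul_mem (hw n) c.2
  have htop : w.ring ≠ ⊤ := by
    obtain ⟨x, hx⟩ := w.exists_notMem
    intro h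
    exact hx (h ▸ ValuationSubring.mem_top x)
  have heq := ValuationSubring.eq_of_le_of_ne_top _ hle htop
  refine ⟨P, fun x => ?_⟩
  rw [← heq, HeightOneSpectrum.valuationSubringAtPrime_eq_valuationSubring]
  rfl

variable (R) in
-- A place is determined by its center, and `x` has a pole at only finitely many primes of `R`.
lemma finite_setOf_notMem_of_dedekind (x : F) :
    {w : FinPlace F | (∀ r : R, algebraMap R F r ∈ w.ring) ∧ x ∉ w.ring}.Finite := by
  have h : ∀ w : {w : FinPlace F | (∀ r : R, algebraMap R F r ∈ w.ring) ∧ x ∉ w.ring},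
      ∃ P : HeightOneSpectrum R, ∀ x : F, x ∈ w.1.ring ↔ P.valuation F x ≤ 1 :=
    fun w => w.1.exists_heightOneSpectrum w.2.1
  choose P hP using h
  have hfin : Finite (HeightOneSpectrum.Support R x) := HeightOneSpectrum.Support.finite R x
  refine Finite.of_injective (β := HeightOneSpectrum.Support R x)
    (fun w => ⟨P w, not_le.mp (mt (hP w x).mpr w.2.2)⟩) fun w w' hww => ?_
  have hPP : P w = P w' := congrArg Subtype.val hww
  apply Subtype.ext
  apply FinPlace.ext
  ext y
  rw [hP w y, hP w' y, hPP]

/-- Approximation in a Dedekind domain at finitely many places. -/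
lemma exists_approx {W : Type*} [Finite W] (w : W → FinPlace F) (hinj : Function.Injective w)
    (hw : ∀ i, ∀ r : R, algebraMap R F r ∈ (w i).ring) (x : W → F) (hx : ∀ i, x i ∈ (w i).ring)
    {t : F} (ht : t ≠ 0) :
    ∃ b : R, ∀ i, (x i - algebraMap R F b) / t ∈ (w i).ring := by
  have := Fintype.ofFinite W
  choose P hP using fun i => (w i).exists_heightOneSpectrum (hw i)
  have hPinj : Function.Injective P := by
    intro i j hij
    apply hinj
    apply FinPlace.ext
    ext y
    rw [hP i y, hP j y, hij]
  have ht' : ∀ i, (P i).valuation F t ≠ 0 := fun i => by simpa using ht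
  -- Each `x i` is first replaced by an element of `R`. The Chinese remainder theorem then glues
  -- these modulo powers of the `P i` high enough to be divisible by `t`.
  choose a ha using fun i => (P i).exists_valuation_sub_lt_of_integer ((hP i _).mp (hx i))
    (Units.mk0 _ (ht' i))
  have hexp : ∀ i, ∃ n : ℕ, WithZero.exp (-(n : ℤ)) ≤ (P i).valuation F t := by
    intro i
    refine ⟨(-WithZero.log ((P i).valuation F t)).toNat, ?_⟩
    rw [← WithZero.le_log_iff_exp_le (ht' i)]
    omega
  choose e he using hexp
  obtain ⟨b, hb⟩ := IsDedekindDomain.exists_forall_sub_mem_ideal (s := Finset.univ)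
    (fun i => (P i).asIdeal) e (fun i _ => (P i).prime)
    (fun i _ j _ hij h => hij (hPinj (HeightOneSpectrum.ext h))) (fun i => a i)
  refine ⟨b, fun i => ?_⟩
  rw [hP, map_div₀]
  refine div_le_one_of_le₀ ?_ zero_le
  have h1 : (P i).valuation F (algebraMap R F (b - a i)) ≤ (P i).valuation F t := by
    refine le_trans ?_ (he i)
    rw [HeightOneSpectrum.valuation_of_algebraMap]
    exact ((P i).intValuation_le_pow_iff_mem _ _).mpr (hb i (Finset.mem_univ i))
  have h2 : x i - algebraMap R F b =
      -((algebraMap R F (a i) - x i) + algebraMap R F (b - a i)) := by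
    rw [map_sub]; ring
  rw [h2, Valuation.map_neg]
  exact (Valuation.map_add _ _ _).trans (max_le (ha i).le h1)

/-- The place given by a maximal ideal with finite residue field of a Dedekind domain. -/
def ofHeightOneSpectrum (P : HeightOneSpectrum R) (hP : Finite (R ⧸ P.asIdeal)) : FinPlace F where
  ring := (P.valuation F).valuationSubring
  isDVR := by
    have : Nontrivial (MonoidWithZeroHom.valueGroup (.ofClass (P.valuation F))) := inferInstance
    infer_instance
  finite_residueField := by
    have hR : ∀ r : R, algebraMap R F r ∈ (P.valuation F).valuationSubring :=
      fun r => P.valuation_le_one r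
    let f : R →+* IsLocalRing.ResidueField (P.valuation F).valuationSubring :=
      (IsLocalRing.residue _).comp ((algebraMap R F).codRestrict _ hR)
    have key : ∀ z : (P.valuation F).valuationSubring, P.valuation F (z : F) < 1 →
        IsLocalRing.residue _ z = 0 := by
      intro z hz
      rw [IsLocalRing.residue_eq_zero_iff, IsLocalRing.mem_maximalIdeal, mem_nonunits_iff]
      intro hu
      obtain ⟨c, hc⟩ := hu.exists_right_inv
      have h1 : P.valuation F (z : F) * P.valuation F (c : F) = 1 := by
        rw [← map_mul, show (z : F) * (c : F) = 1 from congrArg Subtype.val hc, map_one]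
      exact (mul_lt_one_of_lt_of_le hz c.2).ne h1
    have hker : ∀ a ∈ P.asIdeal, f a = 0 := fun a ha =>
      key _ ((P.valuation_lt_one_iff_mem a).mpr ha)
    refine Finite.of_surjective (Ideal.Quotient.lift P.asIdeal f hker)
      (Ideal.Quotient.lift_surjective_of_surjective _ hker ?_)
    intro y
    obtain ⟨y, rfl⟩ := IsLocalRing.residue_surjective y
    obtain ⟨a, ha⟩ := P.exists_valuation_sub_lt_of_integer (x := (y : F)) y.2 1
    refine ⟨a, ?_⟩
    rw [← sub_eq_zero]
    change IsLocalRing.residue _ _ - IsLocalRing.residue _ _ = 0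
    rw [← map_sub]
    exact key _ ha

end Center

section IntegralClosure

lemma mem_ring_of_isIntegral {A L : Type*} [CommRing A] [Field L] [Algebra A L] (w : FinPlace L)
    (hw : ∀ a : A, algebraMap A L a ∈ w.ring) {x : L} (hx : IsIntegral A x) : x ∈ w.ring := by
  obtain ⟨p, hp, hx⟩ := hx
  have hint : IsIntegral w.ring x := ⟨p.map ((algebraMap A L).codRestrict w.ring hw), hp.map _, by
    rw [Polynomial.eval₂_map]
    exact hx⟩
  obtain ⟨y, rfl⟩ := IsIntegrallyClosed.isIntegral_iff.mp hint
  exact y.2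

/-- A valuation ring containing `A` contains its integral closure in `L`, a Dedekind domain with
fraction field `L`. -/
lemma finite_setOf_notMem_of_base (A K : Type*) {L : Type*} [CommRing A] [IsDedekindDomain A]
    [Field K] [Algebra A K] [IsFractionRing A K] [Field L] [Algebra K L] [Algebra A L]
    [IsScalarTower A K L] [FiniteDimensional K L] [Algebra.IsSeparable K L] (x : L) :
    {w : FinPlace L | (∀ a : A, algebraMap A L a ∈ w.ring) ∧ x ∉ w.ring}.Finite := by
  have h1 : IsDedekindDomain (integralClosure A L) := integralClosure.isDedekindDomain A K L
  have h2 : IsFractionRing (integralClosure A L) L :=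
    integralClosure.isFractionRing_of_finite_extension K L
  refine (finite_setOf_notMem_of_dedekind (integralClosure A L) x).subset ?_
  rintro w ⟨hw, hx⟩
  exact ⟨fun r => w.mem_ring_of_isIntegral hw r.2, hx⟩

end IntegralClosure

/-- An element of a global field is integral at all but finitely many non-archimedean places. -/
theorem finite_setOf_notMem {K : Type*} [Field K] [h : GlobalField K] (x : K) :
    {v : FinPlace K | x ∉ v.ring}.Finite := by
  rcases h.out with h | ⟨p, hp, hA, h1, h2⟩
  · refine (finite_setOf_notMem_of_base ℤ ℚ x).subset fun v hv => ⟨fun a => ?_, hv⟩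
    simp
  · classical
    let _ : Algebra (Polynomial (ZMod p)) K :=
      ((algebraMap (RatFunc (ZMod p)) K).comp (algebraMap (Polynomial (ZMod p)) _)).toAlgebra
    have : IsScalarTower (Polynomial (ZMod p)) (RatFunc (ZMod p)) K :=
      IsScalarTower.of_algebraMap_eq fun _ => rfl
    -- The local ring at `t = ∞`, the second chart of the projective line.
    let O := (RatFunc.inftyValuation (ZMod p)).valuationSubring
    let _ : Algebra O K := ((algebraMap (RatFunc (ZMod p)) K).comp (algebraMap O _)).toAlgebra
    have : IsScalarTower O (RatFunc (ZMod p)) K :=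
      IsScalarTower.of_algebraMap_eq fun _ => rfl
    have : IsDiscreteValuationRing O := by
      have : Nontrivial (MonoidWithZeroHom.valueGroup
        (.ofClass (RatFunc.inftyValuation (ZMod p)))) := inferInstance
      infer_instance
    let T : K := algebraMap (RatFunc (ZMod p)) K RatFunc.X
    refine ((finite_setOf_notMem_of_base (Polynomial (ZMod p)) (RatFunc (ZMod p)) x).union
      (finite_setOf_notMem_of_base O (RatFunc (ZMod p)) T)).subset fun v hv => ?_
    have htriv : ((v.prime.valuation K).comap
      (algebraMap (RatFunc (ZMod p)) K)).IsTrivialOn (ZMod p) := inferInstance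
    -- If `t` is integral at `v`, then so is all of `𝔽_p[t]`, since the valuation is trivial on
    -- constants. Otherwise `v` lies above `∞`, and the places where `t` has a pole are finite in
    -- number whatever `x` is.
    by_cases hT : T ∈ v.ring
    · refine Or.inl ⟨fun f => ?_, hv⟩
      rw [mem_ring_iff] at hT ⊢
      exact Polynomial.valuation_le_one_of_valuation_X_le_one (v := (v.prime.valuation K).comap
        (algebraMap (RatFunc (ZMod p)) K)) _ hT f
    · refine Or.inr ⟨fun f => ?_, hT⟩
      rw [mem_ring_iff, not_le] at hT
      have hequiv := RatFunc.valuation_isEquiv_inftyValuation_of_one_lt_valuation_X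
        (v := (v.prime.valuation K).comap (algebraMap (RatFunc (ZMod p)) K)) hT
      rw [mem_ring_iff]
      exact (Valuation.isEquiv_iff_val_le_one.mp hequiv).mpr f.2

end FinPlace

end AdelicRR

/-! ### Places above a given place and the embeddings of completions. -/

namespace AdelicRR

namespace FinPlace

variable {K L : Type*} [Field K] [Field L] [Algebra K L] [Algebra.IsAlgebraic K L]

lemma continuous_completionMap (w : FinPlace L) : Continuous (w.completionMap K) :=
  (UniformSpace.Completion.continuous_extension).comp
    (HeightOneSpectrum.adicCompletion.continuous_toCompletion _ _)

lemma completionMap_algebraMap (w : FinPlace L) (x : K) :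
    w.completionMap K (algebraMap K (w.below K).Completion x) =
      algebraMap L w.Completion (algebraMap K L x) :=
  UniformSpace.Completion.extensionHom_coe (f := _) (w.continuous_toCompletion K)
    ((WithVal.equiv ((w.below K).prime.valuation K)).symm x)

/-- The places of `L` above a place `v` of `K`. -/
@[ext]
structure Over (v : FinPlace K) (L : Type*) [Field L] [Algebra K L] [Algebra.IsAlgebraic K L] where
  /-- The underlying place of `L`. -/
  place : FinPlace L
  below_eq : place.below K = v

namespace Over

variable {v : FinPlace K}

/-- The embedding of completions `K_v → L_w`. -/
def map (w : Over v L) : v.Completion →+* w.1.Completion := by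
  obtain ⟨w, rfl⟩ := w
  exact w.completionMap K

/-- Carrying `below_eq` as data lets all the places above `v` be algebras over the same field, so
that their product is one too. -/
instance (w : Over v L) : Algebra v.Completion w.1.Completion := w.map.toAlgebra

lemma continuous_algebraMap (w : Over v L) :
    Continuous (algebraMap v.Completion w.1.Completion) := by
  obtain ⟨w, rfl⟩ := w
  exact w.continuous_completionMap

lemma algebraMap_algebraMap (w : Over v L) (x : K) :
    algebraMap v.Completion w.1.Completion (algebraMap K v.Completion x) =
      algebraMap L w.1.Completion (algebraMap K L x) := by
  obtain ⟨w, rfl⟩ := w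
  exact w.completionMap_algebraMap x

lemma algebraMap_mem_ring_iff (w : Over v L) (x : K) :
    algebraMap K L x ∈ w.1.ring ↔ x ∈ v.ring := by
  obtain ⟨w, rfl⟩ := w
  rfl

/-- The rings of integers are closed and `O_v` is also open, so the implication is a closed
condition on `x`. It can be checked on the dense subfield `K`. -/
lemma algebraMap_mem_integers (w : Over v L) {x : v.Completion} (hx : x ∈ v.integers) :
    algebraMap v.Completion w.1.Completion x ∈ w.1.integers := by
  have hcl : IsClosed {x : v.Completion |
      x ∈ v.integers → algebraMap v.Completion w.1.Completion x ∈ w.1.integers} := by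
    have := v.isOpen_integers.isClosed_compl.union
      (w.1.isClosed_integers.preimage w.continuous_algebraMap)
    convert! this using 1
    ext x
    simp [imp_iff_not_or]
  refine (HeightOneSpectrum.denseRange_algebraMap K v.prime).induction_on
    (p := fun x => x ∈ v.integers → algebraMap v.Completion w.1.Completion x ∈ w.1.integers)
    x hcl (fun k hk => ?_) hx
  rw [algebraMap_mem_integers_iff] at hk
  rwa [algebraMap_algebraMap, algebraMap_mem_integers_iff, algebraMap_mem_ring_iff]

section Trans

variable {Q : Type*} [Field Q] [Algebra Q K] [Algebra Q L] [IsScalarTower Q K L]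
  [Algebra.IsAlgebraic Q K] [Algebra.IsAlgebraic Q L] {u : FinPlace Q}

lemma below_below (w : FinPlace L) :
    (w.below K).below Q = w.below Q := by
  apply FinPlace.ext
  ext x
  change algebraMap K L (algebraMap Q K x) ∈ w.ring ↔ algebraMap Q L x ∈ w.ring
  rw [IsScalarTower.algebraMap_apply Q K L]

/-- A place above a place above `u` lies above `u`. -/
def trans (v : Over u K) (w : Over v.place L) : Over u L where
  place := w.place
  below_eq := by rw [← below_below (K := K), w.below_eq, v.below_eq]

/-- Both sides are continuous and agree on the dense subfield `Q`. -/
lemma trans_algebraMap (v : Over u K) (w : Over v.place L) (x : u.Completion) :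
    algebraMap u.Completion (v.trans w).place.Completion x =
      algebraMap v.place.Completion w.place.Completion
        (algebraMap u.Completion v.place.Completion x) := by
  refine congrFun (DenseRange.equalizer (HeightOneSpectrum.denseRange_algebraMap Q u.prime)
    (v.trans w).continuous_algebraMap
    (w.continuous_algebraMap.comp v.continuous_algebraMap) (funext fun q => ?_)) x
  exact ((v.trans w).algebraMap_algebraMap q).trans <|
    (congrArg (algebraMap L w.place.Completion) (IsScalarTower.algebraMap_apply Q K L q)).trans <|
    (w.algebraMap_algebraMap (algebraMap Q K q)).symm.trans <|
    congrArg (algebraMap v.place.Completion w.place.Completion) (v.algebraMap_algebraMap q).symm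

end Trans

end Over

end FinPlace

end AdelicRR

/-! ### The integral closure of a valuation ring and the places above it. -/

namespace AdelicRR

namespace FinPlace

variable {K L : Type*} [Field K] [Field L] [Algebra K L]

/-- The integral closure in `L` of the valuation ring of `v`. -/
def integralSubring (v : FinPlace K) (L : Type*) [Field L] [Algebra K L] : Subring L :=
  (integralClosure v.ring L).toSubring

lemma mem_integralSubring (v : FinPlace K) (x : L) :
    x ∈ v.integralSubring L ↔ IsIntegral v.ring x := Iff.rfl

section IsAlgebraic

variable [Algebra.IsAlgebraic K L]

lemma Over.algebraMap_ring_mem {v : FinPlace K} (w : Over v L) (a : v.ring) :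
    algebraMap v.ring L a ∈ w.1.ring := (w.algebraMap_mem_ring_iff a).mpr a.2

lemma mem_ring_unif_inv (v : FinPlace K) : v.unif⁻¹ ∉ v.ring := by
  rw [mem_ring_iff, map_inv₀, valuation_unif]
  decide

lemma Over.of_algebraMap_mem {v : FinPlace K} {w : FinPlace L}
    (h : ∀ a : v.ring, algebraMap v.ring L a ∈ w.ring) : w.below K = v :=
  (eq_of_ring_le fun x hx => h ⟨x, hx⟩ : v = w.below K).symm

end IsAlgebraic

variable [FiniteDimensional K L] [Algebra.IsSeparable K L]

/-- The inverse of a uniformizer of `v` has a pole at every place above `v`. -/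
instance (v : FinPlace K) : Finite (Over v L) := by
  have hfin : Finite {w : FinPlace L | (∀ a : v.ring, algebraMap v.ring L a ∈ w.ring) ∧
    algebraMap K L v.unif⁻¹ ∉ w.ring} := finite_setOf_notMem_of_base v.ring K _
  have hmem : ∀ w : Over v L, algebraMap K L v.unif⁻¹ ∉ w.1.ring := fun w => by
    rw [w.algebraMap_mem_ring_iff]
    exact v.mem_ring_unif_inv
  exact Finite.of_injective (β := {w : FinPlace L |
    (∀ a : v.ring, algebraMap v.ring L a ∈ w.ring) ∧ algebraMap K L v.unif⁻¹ ∉ w.ring})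
    (fun w : Over v L => ⟨w.1, w.algebraMap_ring_mem, hmem w⟩)
    fun w w' h => Over.ext (Subtype.mk.inj h)

lemma finite_quotient_integralClosure (v : FinPlace K)
    (P : HeightOneSpectrum (integralClosure v.ring L)) :
    Finite (integralClosure v.ring L ⧸ P.asIdeal) := by
  have hfin : Module.Finite v.ring (integralClosure v.ring L) :=
    IsIntegralClosure.finite v.ring K L (integralClosure v.ring L)
  have hp : P.asIdeal.under v.ring = IsLocalRing.maximalIdeal v.ring := by
    have h1 : P.asIdeal.under v.ring ≠ ⊥ := fun h => P.ne_bot (Ideal.eq_bot_of_comap_eq_bot h)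
    have h2 : (P.asIdeal.under v.ring).IsPrime := Ideal.IsPrime.under _ _
    exact IsLocalRing.eq_maximalIdeal (h2.isMaximal h1)
  have h3 : Finite (v.ring ⧸ P.asIdeal.under v.ring) := by
    rw [hp]
    exact v.finite_residueField
  exact Module.finite_of_finite (v.ring ⧸ P.asIdeal.under v.ring)

/-- The integral closure of a valuation ring is the intersection of the valuation rings above. -/
lemma isIntegral_iff (v : FinPlace K) (x : L) :
    IsIntegral v.ring x ↔ ∀ w : Over v L, x ∈ w.1.ring := by
  refine ⟨fun h w => w.1.mem_ring_of_isIntegral w.algebraMap_ring_mem h, fun h => ?_⟩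
  have h1 : IsDedekindDomain (integralClosure v.ring L) :=
    integralClosure.isDedekindDomain v.ring K L
  have h2 : IsFractionRing (integralClosure v.ring L) L :=
    integralClosure.isFractionRing_of_finite_extension K L
  -- A Dedekind domain is the intersection of its localizations, and each prime of the integral
  -- closure gives a place above `v`.
  obtain ⟨y, rfl⟩ := HeightOneSpectrum.mem_integers_of_valuation_le_one
    (R := integralClosure v.ring L) L x fun P => by
      let w : FinPlace L := ofHeightOneSpectrum P (v.finite_quotient_integralClosure P)
      have hw : w.below K = v := Over.of_algebraMap_mem fun a =>
        P.valuation_le_one (algebraMap v.ring (integralClosure v.ring L) a)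
      exact h ⟨w, hw⟩
  exact y.2

/-- Separability makes the integral closure finite over the principal ideal domain `v.ring`. It
spans `L` because every element has a non-zero integral multiple. -/
lemma exists_isIntegralBasis_integralSubring (v : FinPlace K) (L : Type*) [Field L] [Algebra K L]
    [FiniteDimensional K L] [Algebra.IsSeparable K L] :
    ∃ b : Module.Basis (Fin (Module.finrank K L)) K L,
      IsIntegralBasis v.ring (v.integralSubring L : Set L) b := by
  have hfin : Module.Finite v.ring (integralClosure v.ring L) :=
    IsIntegralClosure.finite v.ring K L (integralClosure v.ring L)
  refine exists_isIntegralBasis (Subalgebra.toSubmodule (integralClosure v.ring L))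
    (Module.Finite.iff_fg.mp hfin) (eq_top_iff.mpr fun x _ => ?_)
  have halg : IsAlgebraic v.ring x :=
    (IsFractionRing.isAlgebraic_iff v.ring K L).mpr (Algebra.IsAlgebraic.isAlgebraic x)
  obtain ⟨a, ha, hx⟩ := halg.exists_integral_multiple
  have ha' : (a : K) ≠ 0 := fun h => ha (Subtype.ext h)
  have hx' : x = (a : K)⁻¹ • (a • x) := by
    rw [← algebraMap_smul K a x, smul_smul]
    exact (inv_mul_cancel₀ ha' ▸ one_smul K x).symm
  rw [hx']
  exact Submodule.smul_mem _ _ (Submodule.subset_span hx)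

end FinPlace

end AdelicRR

/-! ### The product of the completions above a place. -/

namespace AdelicRR

namespace FinPlace

open Filter Topology

lemma tendsto_zero_of_valued_le_pow {F : Type*} [Field F] (w : FinPlace F) {r : w.Completion}
    (hr : Valued.v r < 1) {f : ℕ → w.Completion} (h : ∀ n, Valued.v (f n) ≤ Valued.v r ^ n) :
    Tendsto f atTop (𝓝 0) := by
  rw [tendsto_iff_forall_eventually_mem]
  intro U hU
  obtain ⟨γ, hγ⟩ := Valued.mem_nhds_zero.mp hU
  obtain ⟨N, hN⟩ : ∃ N : ℕ, Valued.v r ^ N < MonoidWithZeroHom.ValueGroup₀.embedding γ.1 :=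
    exists_pow_lt₀ hr (Units.map (MonoidWithZeroHom.ValueGroup₀.embedding
      (f := .ofClass (Valued.v : Valuation w.Completion _))).toMonoidHom γ)
  filter_upwards [eventually_ge_atTop N] with n hn
  apply hγ
  change Valued.v.restrict (f n) < γ.1
  rw [Valuation.restrict_lt_iff_lt_embedding]
  exact ((h n).trans (pow_le_pow_right_of_le_one' hr.le hn)).trans_lt hN

variable {K L : Type*} [Field K] [Field L] [Algebra K L]

lemma Over.valued_unif_lt_one [Algebra.IsAlgebraic K L] {v : FinPlace K} (w : Over v L) :
    Valued.v (algebraMap L w.1.Completion (algebraMap K L v.unif)) < 1 := by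
  by_contra! h
  apply v.mem_ring_unif_inv
  rw [← w.algebraMap_mem_ring_iff, mem_ring_iff, map_inv₀, map_inv₀, ← valued_algebraMap]
  exact inv_le_one_of_one_le₀ h

variable [FiniteDimensional K L] [Algebra.IsSeparable K L]

/-- Elements of the integral closure approximate families of integers at the places above `v`. -/
lemma exists_mem_integralSubring_approx (v : FinPlace K) {y : ∀ w : Over v L, w.1.Completion}
    (hy : ∀ w, y w ∈ w.1.integers) {t : L} (ht : t ≠ 0) (htv : ∀ w : Over v L, t ∈ w.1.ring) :
    ∃ x ∈ v.integralSubring L, ∀ w : Over v L,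
      Valued.v (y w - algebraMap L w.1.Completion x) ≤
        Valued.v (algebraMap L w.1.Completion t) := by
  have h1 : IsDedekindDomain (integralClosure v.ring L) :=
    integralClosure.isDedekindDomain v.ring K L
  have h2 : IsFractionRing (integralClosure v.ring L) L :=
    integralClosure.isFractionRing_of_finite_extension K L
  choose k hk hk' using fun w : Over v L => w.1.exists_mem_ring_sub (hy w)
    (r := algebraMap L w.1.Completion t) (by simpa using ht)
    ((w.1.algebraMap_mem_integers_iff _).mpr (htv w))
  obtain ⟨b, hb⟩ := exists_approx (R := integralClosure v.ring L) (fun w : Over v L => w.1)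
    (fun _ _ h => Over.ext h) (fun w r => (v.isIntegral_iff (r : L)).mp r.2 w) k hk ht
  refine ⟨b, b.2, fun w => ?_⟩
  have h3 := (w.1.mem_ring_iff _).mp (hb w)
  rw [map_div₀, div_le_one₀ (by simpa [zero_lt_iff] using ht), ← valued_algebraMap,
    ← valued_algebraMap, map_sub] at h3
  rw [← sub_add_sub_cancel _ (algebraMap L w.1.Completion (k w))]
  exact (Valuation.map_add _ _ _).trans (max_le (hk' w).le h3)

variable {ι : Type*} [Fintype ι] {v : FinPlace K} {b : Module.Basis ι K L}

/-- A compactness argument: the combinations with coefficients in `O_v` form a compact, hence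
closed, set. It contains the integral closure, which is dense in `∏ O_w` by approximation modulo
powers of the uniformizer. -/
lemma exists_sum_smul_eq (hb : IsIntegralBasis v.ring (v.integralSubring L : Set L) b)
    {y : ∀ w : Over v L, w.1.Completion} (hy : ∀ w, y w ∈ w.1.integers) :
    ∃ c : ι → v.integers,
      ∑ i, (c i : v.Completion) • (fun w : Over v L => algebraMap L w.1.Completion (b i)) = y := by
  let g : (ι → v.integers) → ∀ w : Over v L, w.1.Completion := fun c =>
    ∑ i, (c i : v.Completion) • (fun w : Over v L => algebraMap L w.1.Completion (b i))
  have hg : Continuous g := by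
    refine continuous_finsetSum _ fun i _ => continuous_pi fun w => ?_
    simp only [Pi.smul_apply, Algebra.smul_def]
    exact (w.continuous_algebraMap.comp
      (continuous_subtype_val.comp (continuous_apply i))).mul continuous_const
  have hclosed : IsClosed (Set.range g) := (isCompact_range hg).isClosed
  have ht : ∀ n : ℕ, algebraMap K L v.unif ^ n ≠ 0 := fun n =>
    pow_ne_zero _ (by simpa using v.unif_ne_zero)
  have htv : ∀ (n : ℕ) (w : Over v L), algebraMap K L v.unif ^ n ∈ w.1.ring := fun n w =>
    pow_mem ((w.algebraMap_mem_ring_iff _).mpr v.unif_mem) n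
  choose x hx hxy using fun n => v.exists_mem_integralSubring_approx hy (ht n) (htv n)
  have hlim : Tendsto (fun n => (fun w : Over v L => algebraMap L w.1.Completion (x n)))
      atTop (𝓝 y) := by
    rw [tendsto_pi_nhds]
    intro w
    have h := w.1.tendsto_zero_of_valued_le_pow (w.valued_unif_lt_one)
      (f := fun n => y w - algebraMap L w.1.Completion (x n)) (fun n => by
        rw [← map_pow, ← map_pow]
        exact hxy n w)
    simpa using h.const_sub (y w)
  refine hclosed.mem_of_tendsto hlim (Eventually.of_forall fun n => ?_)
  choose a ha using fun i => hb.repr_mem (x n) (hx n) i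
  refine ⟨fun i => algebraMap v.ring v.integers (a i), ?_⟩
  funext w
  simp only [g, Finset.sum_apply, Pi.smul_apply]
  conv_rhs => rw [← b.sum_repr (x n), map_sum]
  refine Finset.sum_congr rfl fun i _ => ?_
  rw [← ha, Algebra.smul_def, Algebra.smul_def, map_mul, ← w.algebraMap_algebraMap]
  rfl

/-- Scale a relation so that all coefficients are integral and one equals `1`, and approximate them
by `a i` in `v.ring` modulo a uniformizer `π`. Then `∑ (a i / π) • b i` is integral at every `w`, so
its coordinates lie in `v.ring`; but the `a i` close to `1` is not divisible by `π`. -/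
lemma linearIndependent_completion (hb : IsIntegralBasis v.ring (v.integralSubring L : Set L) b) :
    LinearIndependent v.Completion
      (fun i => (fun w : Over v L => algebraMap L w.1.Completion (b i))) := by
  rw [Fintype.linearIndependent_iff]
  intro c hc
  by_contra! hne
  obtain ⟨j, hj⟩ := hne
  have : Nonempty ι := ⟨j⟩
  obtain ⟨i₀, hi₀⟩ := Finite.exists_max fun i => Valued.v (c i)
  have hc0 : c i₀ ≠ 0 := by
    intro h0
    have := hi₀ j
    rw [h0, map_zero, le_zero_iff, map_eq_zero] at this
    exact hj this
  have hint : ∀ i, c i / c i₀ ∈ v.integers := fun i => by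
    rw [mem_integers_iff, map_div₀]
    exact div_le_one_of_le₀ (hi₀ i) zero_le
  have hu : algebraMap K v.Completion v.unif ≠ 0 := by simpa using v.unif_ne_zero
  choose a ha ha' using fun i => v.exists_mem_ring_sub (hint i) hu
    ((v.algebraMap_mem_integers_iff _).mpr v.unif_mem)
  have hx : (∑ i, (a i / v.unif) • b i) ∈ v.integralSubring L := by
    rw [mem_integralSubring, isIntegral_iff]
    intro w
    rw [← algebraMap_mem_integers_iff, map_sum]
    have hw : ∑ i, algebraMap v.Completion w.1.Completion
        (c i / c i₀ / algebraMap K v.Completion v.unif) *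
          algebraMap L w.1.Completion (b i) = 0 := by
      have h1 := congrFun hc w
      simp only [Finset.sum_apply, Pi.smul_apply, Pi.zero_apply] at h1
      rw [← zero_mul (algebraMap v.Completion w.1.Completion
        (c i₀ * algebraMap K v.Completion v.unif)⁻¹), ← h1, Finset.sum_mul]
      refine Finset.sum_congr rfl fun i _ => ?_
      rw [div_div, div_eq_mul_inv, map_mul, mul_right_comm, Algebra.smul_def]
    rw [← sub_zero (∑ i, _), ← hw, ← Finset.sum_sub_distrib]
    refine sum_mem fun i _ => ?_
    rw [Algebra.smul_def, map_mul, ← w.algebraMap_algebraMap, ← sub_mul, ← map_sub]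
    refine mul_mem (w.algebraMap_mem_integers ?_) ((w.1.algebraMap_mem_integers_iff _).mpr
      ((v.isIntegral_iff _).mp (hb.mem i) w))
    rw [map_div₀, ← sub_div, mem_integers_iff, map_div₀, Valuation.map_sub_swap]
    exact div_le_one_of_le₀ (ha' i).le zero_le
  obtain ⟨d, hd⟩ := hb.repr_mem _ hx i₀
  rw [b.repr_sum_self] at hd
  have h1 : Valued.v (algebraMap K v.Completion (a i₀)) < 1 := by
    have h2 : a i₀ = v.unif * (d : K) := by
      rw [show (d : K) = a i₀ / v.unif from hd, mul_div_cancel₀ _ v.unif_ne_zero]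
    rw [h2, map_mul, map_mul, valued_unif]
    exact mul_lt_one_of_lt_of_le (by decide) ((v.algebraMap_mem_integers_iff _).mpr d.2)
  have h2 : Valued.v (1 - algebraMap K v.Completion (a i₀)) < 1 := by
    have := ha' i₀
    rw [div_self hc0, valued_unif] at this
    exact this.trans (by decide)
  have h3 := Valuation.map_add_lt _ h2 h1
  rw [sub_add_cancel, map_one] at h3
  exact lt_irrefl _ h3

/-- An integral basis of `L` at `v` is an integral basis of the product of the completions of `L`
above `v`. -/
theorem exists_isIntegralBasis_pi
    (hb : IsIntegralBasis v.ring (v.integralSubring L : Set L) b) :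
    ∃ β : Module.Basis ι v.Completion (∀ w : Over v L, w.1.Completion),
      (∀ i w, β i w = algebraMap L w.1.Completion (b i)) ∧
      IsIntegralBasis v.integers
        (Set.univ.pi fun w : Over v L => (w.1.integers : Set w.1.Completion)) β := by
  have hli := linearIndependent_completion hb
  have hsp : ⊤ ≤ Submodule.span v.Completion
      (Set.range fun i => (fun w : Over v L => algebraMap L w.1.Completion (b i))) := by
    intro y _
    -- A power of the uniformizer of `v`, common to all `w`, clears the denominators of `y` and
    -- reduces spanning to the integral case.
    have hu : ∀ w : Over v L, ∃ n : ℕ,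
        Valued.v (algebraMap L w.1.Completion (algebraMap K L v.unif)) ^ n * Valued.v (y w) ≤ 1 := by
      intro w
      rcases eq_or_ne (y w) 0 with h0 | h0
      · exact ⟨0, by simp [h0]⟩
      have h0' : Valued.v (y w) ≠ 0 := by simpa using h0
      obtain ⟨n, hn⟩ := exists_pow_lt₀ w.valued_unif_lt_one (Units.mk0 _ (inv_ne_zero h0'))
      refine ⟨n, ?_⟩
      rw [← le_div_iff₀ (zero_lt_iff.mpr h0'), one_div]
      exact hn.le
    choose n hn using hu
    have := Fintype.ofFinite (Over v L)
    let N := ∑ w, n w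
    have hu0 : algebraMap K v.Completion v.unif ≠ 0 := by simpa using v.unif_ne_zero
    have hmem : ∀ w, (algebraMap K v.Completion v.unif ^ N • y) w ∈ w.1.integers := by
      intro w
      rw [Pi.smul_apply, Algebra.smul_def, mem_integers_iff, map_pow, w.algebraMap_algebraMap,
        map_mul, map_pow]
      refine le_trans ?_ (hn w)
      exact mul_le_mul_left (pow_le_pow_right_of_le_one' w.valued_unif_lt_one.le
        (Finset.single_le_sum (f := n) (fun _ _ => Nat.zero_le _) (Finset.mem_univ w))) _
    obtain ⟨c, hc⟩ := exists_sum_smul_eq hb hmem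
    have hy : y = (algebraMap K v.Completion v.unif ^ N)⁻¹ •
        (algebraMap K v.Completion v.unif ^ N • y) := by
      rw [smul_smul, inv_mul_cancel₀ (pow_ne_zero _ hu0), one_smul]
    rw [hy, ← hc]
    refine Submodule.smul_mem _ _ (sum_mem fun i _ => Submodule.smul_mem _ _ ?_)
    exact Submodule.subset_span ⟨i, rfl⟩
  refine ⟨Module.Basis.mk hli hsp, fun i w => by rw [Module.Basis.mk_apply], fun i w _ => ?_,
    fun y hy i => ?_⟩
  · rw [Module.Basis.mk_apply]
    exact (w.1.algebraMap_mem_integers_iff _).mpr ((v.isIntegral_iff _).mp (hb.mem i) w)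
  · obtain ⟨c, hc⟩ := exists_sum_smul_eq hb fun w => hy w trivial
    refine ⟨c i, ?_⟩
    have : y = ∑ i, (c i : v.Completion) • Module.Basis.mk hli hsp i := by
      rw [← hc]
      simp_rw [Module.Basis.mk_apply]
    rw [this, Module.Basis.repr_sum_self]
    rfl

end FinPlace

end AdelicRR

/-! ### Local and global discriminants at a place. -/

namespace AdelicRR

namespace FinPlace

open Module

lemma one_le_idealNorm_span_singleton {F : Type*} [Field F] (v : FinPlace F) {x : v.integers}
    (hx : x ≠ 0) : 1 ≤ idealNorm (Ideal.span {x}) := by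
  have h := v.absVal_pos (x := (x : v.Completion)) fun h => hx (Subtype.ext h)
  have h1 := v.idealNorm_span_singleton hx
  have h2 : 0 < idealNorm (Ideal.span {x}) := by
    rw [h1]
    positivity
  rw [idealNorm] at h2 ⊢
  exact_mod_cast h2

variable {K L : Type*} [Field K] [Field L] [Algebra K L]

/-- The discriminant ideal of `L_w` over `K_v`. -/
def Over.localDisc [Algebra.IsAlgebraic K L] {v : FinPlace K} (w : Over v L) : Ideal v.integers :=
  discriminantIdeal v.integers (F := v.Completion) (w.1.integers : Set w.1.Completion)

lemma Over.idealNorm_localDiscriminant [Algebra.IsAlgebraic K L] {v : FinPlace K} (w : Over v L) :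
    idealNorm (localDiscriminant K w.1) = idealNorm w.localDisc := by
  obtain ⟨w, rfl⟩ := w
  rfl

variable [FiniteDimensional K L] [Algebra.IsSeparable K L] {v : FinPlace K}

instance : Module.Finite v.Completion (∀ w : Over v L, w.1.Completion) := by
  obtain ⟨b, hb⟩ := v.exists_isIntegralBasis_integralSubring L
  obtain ⟨β, -, -⟩ := exists_isIntegralBasis_pi hb
  exact Module.Finite.of_basis β

instance (w : Over v L) : FiniteDimensional v.Completion w.1.Completion :=
  Module.Finite.of_surjective
    (LinearMap.proj w : (∀ w : Over v L, w.1.Completion) →ₗ[v.Completion] w.1.Completion)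
    (Function.surjective_eval w)

/-- Both sides count the vectors of a basis of the product of completions that comes from a basis of
`L`. -/
lemma sum_finrank_completion (v : FinPlace K) [Fintype (Over v L)] :
    ∑ w : Over v L, finrank v.Completion w.1.Completion = finrank K L := by
  obtain ⟨b, hb⟩ := v.exists_isIntegralBasis_integralSubring L
  obtain ⟨β, -, -⟩ := exists_isIntegralBasis_pi hb
  have hfree : ∀ w : Over v L, Module.Free v.Completion w.1.Completion := fun w =>
    Module.Free.of_divisionRing _ _
  rw [← Module.finrank_pi_fintype, Module.finrank_eq_card_basis β, Fintype.card_fin]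

/-- The ring of integers of `L_w` has an integral basis over that of `K_v`. -/
lemma Over.exists_isIntegralBasis (w : Over v L) :
    ∃ c : Basis (Fin (finrank v.Completion w.1.Completion)) v.Completion w.1.Completion,
      IsIntegralBasis v.integers (w.1.integers.toSubring : Set w.1.Completion) c := by
  classical
  obtain ⟨b, hb⟩ := v.exists_isIntegralBasis_integralSubring L
  obtain ⟨β, hβ, hβi⟩ := exists_isIntegralBasis_pi hb
  let N : Submodule v.integers w.1.Completion :=
    { carrier := w.1.integers
      add_mem' := fun h h' => add_mem h h'
      zero_mem' := zero_mem _
      smul_mem' := fun a x hx => by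
        rw [Algebra.smul_def]
        exact mul_mem (w.algebraMap_mem_integers a.2) hx }
  have hβN : ∀ i, β i w ∈ N := fun i => hβi.mem i w trivial
  -- `O_w` is the projection of `∏ O_w`, so the `w`-components of the global basis generate it,
  -- though they need not be independent.
  have hN : N = Submodule.span v.integers (Set.range fun i => β i w) := by
    apply le_antisymm
    · intro y hy
      have hmem : ∀ w', (Pi.single w y : ∀ w : Over v L, w.1.Completion) w' ∈ w'.1.integers := by
        intro w'
        by_cases h : w' = w
        · subst h
          rw [Pi.single_eq_same]
          exact hy
        · rw [Pi.single_eq_of_ne h]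
          exact zero_mem _
      obtain ⟨c, hc⟩ := exists_sum_smul_eq hb hmem
      have h1 := congrFun hc w
      rw [Pi.single_eq_same, Finset.sum_apply] at h1
      rw [← h1]
      refine sum_mem fun i _ => ?_
      rw [Pi.smul_apply, ← hβ]
      exact Submodule.smul_mem _ (c i) (Submodule.subset_span ⟨i, rfl⟩)
    · rw [Submodule.span_le]
      rintro _ ⟨i, rfl⟩
      exact hβN i
  refine AdelicRR.exists_isIntegralBasis N (hN ▸ Submodule.fg_span (Set.finite_range _))
    (eq_top_iff.mpr fun y _ => ?_)
  have h1 := congrFun (β.sum_repr (Pi.single w y)) w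
  rw [Pi.single_eq_same, Finset.sum_apply] at h1
  rw [← h1]
  exact sum_mem fun i _ => Submodule.smul_mem _ _ (Submodule.subset_span (hβN i))

/-- The global discriminant at a place is the product of the local ones. -/
theorem exists_globalDiscriminantAt_eq (v : FinPlace K) [Fintype (Over v L)] :
    ∃ D : v.ring, D ≠ 0 ∧ globalDiscriminantAt K L v = Ideal.span {D} ∧
      (∀ w : Over v L, ∃ d : v.integers, d ≠ 0 ∧ w.localDisc = Ideal.span {d}) ∧
      (v.absVal (algebraMap K v.Completion D))⁻¹ = ∏ w : Over v L, idealNorm w.localDisc := by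
  classical
  obtain ⟨b, hb⟩ := v.exists_isIntegralBasis_integralSubring L
  obtain ⟨β, hβ, hβi⟩ := exists_isIntegralBasis_pi hb
  choose c hc using fun w : Over v L => w.exists_isIntegralBasis
  obtain ⟨D, hD⟩ := hb.discr_mem
  have hD0 : (D : K) ≠ 0 := by
    have := Algebra.discr_not_zero_of_basis K b
    rwa [← hD] at this
  have hpi := IsIntegralBasis.pi (fun w : Over v L => zero_mem w.1.integers) hc
  have hdisc : Algebra.discr v.Completion β =
      algebraMap K v.Completion (Algebra.discr K b) := by
    refine discr_map_basis (algebraMap K v.Completion)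
      (RingHom.pi fun w : Over v L => algebraMap L w.1.Completion) (fun x => ?_) b β
      fun i => funext fun w => hβ i w
    funext w
    exact (w.algebraMap_algebraMap x).symm
  have hβ0 : Algebra.discr v.Completion β ≠ 0 := by
    rw [hdisc, ← hD]
    simpa using hD0
  -- Both the image of the global basis and the union of the local bases are integral bases of `∏
  -- O_w`.
  obtain ⟨a, ha, hac⟩ := hβi.exists_isUnit_discr_eq hpi hβ0
  rw [discr_pi_basis] at hac
  choose d hd using fun w => (hc w).discr_mem
  have hprod : ∏ w, (d w : v.Completion) = a * algebraMap K v.Completion D := by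
    have h : (algebraMap v.ring K) D = (D : K) := rfl
    rw [← h, hD, ← hdisc]
    simp_rw [← hd] at hac
    exact hac
  have ha0 : (a : v.Completion) ≠ 0 := fun h => ha.ne_zero (Subtype.ext h)
  have hd0 : ∀ w, d w ≠ 0 := by
    intro w h
    have h0 : ∏ w, (d w : v.Completion) = 0 := Finset.prod_eq_zero (Finset.mem_univ w) (by rw [h]; rfl)
    rw [h0, eq_comm, mul_eq_zero] at hprod
    exact hprod.elim ha0 (by simpa using hD0)
  have hdisc' : ∀ w : Over v L, w.localDisc = Ideal.span {d w} := fun w =>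
    (hc w).discriminantIdeal_eq (hd w)
  refine ⟨D, fun h => hD0 (by rw [h]; rfl), hb.discriminantIdeal_eq hD, fun w => ⟨d w, hd0 w, hdisc' w⟩, ?_⟩
  simp_rw [hdisc', v.idealNorm_span_singleton (hd0 _)]
  rw [Finset.prod_inv_distrib, ← absVal_prod]
  rw [hprod, absVal_mul, v.absVal_unit a ha, one_mul]

lemma Over.one_le_idealNorm_localDisc (w : Over v L) : 1 ≤ idealNorm w.localDisc := by
  have := Fintype.ofFinite (Over v L)
  obtain ⟨D, -, -, h, -⟩ := v.exists_globalDiscriminantAt_eq (L := L)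
  obtain ⟨d, hd0, hd⟩ := h w
  rw [hd]
  exact v.one_le_idealNorm_span_singleton hd0

end FinPlace

end AdelicRR

/-! ### Absolute values and norms; local discriminants in a tower. -/

namespace AdelicRR

namespace FinPlace

open Module

variable {K L : Type*} [Field K] [Field L] [Algebra K L]
  [FiniteDimensional K L] [Algebra.IsSeparable K L] {v : FinPlace K}

namespace Over

/-- The uniformizer of `K_v` has absolute value `(#k(v))⁻ⁿ` in `L_w`, where `n = [L_w : K_v]`. -/
lemma absVal_unif (w : Over v L) :
    w.place.absVal (algebraMap v.Completion w.place.Completion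
      (algebraMap K v.Completion v.unif)) =
    ((v.residueCard : ℝ) ^ finrank v.Completion w.place.Completion)⁻¹ := by
  obtain ⟨c, hc⟩ := w.exists_isIntegralBasis
  have hu0 : algebraMap K v.Completion v.unif ≠ 0 := by simpa using v.unif_ne_zero
  set u : v.integers := ⟨algebraMap K v.Completion v.unif,
    (v.algebraMap_mem_integers_iff _).mpr v.unif_mem⟩ with hu
  set u' : w.place.integers := ⟨algebraMap v.Completion w.place.Completion
    (algebraMap K v.Completion v.unif), w.algebraMap_mem_integers u.2⟩ with hu'
  have hu0' : u' ≠ 0 := by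
    intro h
    have : algebraMap v.Completion w.place.Completion (algebraMap K v.Completion v.unif) = 0 :=
      congrArg Subtype.val h
    rw [map_eq_zero] at this
    exact hu0 this
  choose r hr using fun (x : w.place.integers) i => hc.repr_mem x.1 x.2 i
  have hinj : Function.Injective (algebraMap v.integers v.Completion) := Subtype.val_injective
  -- Reducing coordinates modulo the uniformizer `u` of `v` identifies `O_w / u O_w` with `n` copies
  -- of `O_v / u`; comparing cardinalities gives the absolute value.
  let f : w.place.integers →+ (Fin (finrank v.Completion w.place.Completion) →
      v.integers ⧸ Ideal.span {u}) :=
    { toFun := fun x i => Ideal.Quotient.mk _ (r x i)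
      map_zero' := by
        funext i
        have : r 0 i = 0 := by
          apply hinj
          rw [hr, map_zero]
          simp
        rw [this, map_zero]
        rfl
      map_add' := fun x y => by
        funext i
        have : r (x + y) i = r x i + r y i := by
          apply hinj
          rw [map_add, hr, hr, hr]
          change c.repr ((x : w.place.Completion) + (y : w.place.Completion)) i = _
          rw [map_add, Finsupp.add_apply]
        rw [this, map_add]
        rfl }
  have hsurj : Function.Surjective f := by
    intro z
    choose a ha using fun i => Ideal.Quotient.mk_surjective (z i)
    have hmem : ∑ i, (a i : v.Completion) • c i ∈ w.place.integers := by
      refine sum_mem fun i _ => ?_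
      rw [Algebra.smul_def]
      exact mul_mem (w.algebraMap_mem_integers (a i).2) (hc.mem i)
    refine ⟨⟨_, hmem⟩, funext fun i => ?_⟩
    have : r ⟨_, hmem⟩ i = a i := by
      apply hinj
      rw [hr, c.repr_sum_self]
      rfl
    change Ideal.Quotient.mk _ (r _ i) = _
    rw [this, ha]
  have hker : f.ker = (Ideal.span {u'}).toAddSubgroup := by
    ext x
    rw [AddMonoidHom.mem_ker, Submodule.mem_toAddSubgroup, Ideal.mem_span_singleton]
    constructor
    · intro h
      have h1 : ∀ i, ∃ s, r x i = u * s := fun i => by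
        have := congrFun h i
        exact Ideal.mem_span_singleton.mp (Ideal.Quotient.eq_zero_iff_mem.mp this)
      choose s hs using h1
      have hmem : ∑ i, (s i : v.Completion) • c i ∈ w.place.integers := by
        refine sum_mem fun i _ => ?_
        rw [Algebra.smul_def]
        exact mul_mem (w.algebraMap_mem_integers (s i).2) (hc.mem i)
      refine ⟨⟨_, hmem⟩, Subtype.ext ?_⟩
      change (x : w.place.Completion) = algebraMap v.Completion w.place.Completion
        (algebraMap K v.Completion v.unif) * ∑ i, (s i : v.Completion) • c i
      rw [← Algebra.smul_def, Finset.smul_sum, ← c.sum_repr (x : w.place.Completion)]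
      refine Finset.sum_congr rfl fun i _ => ?_
      rw [smul_smul, ← hr, hs]
      rfl
    · rintro ⟨y, rfl⟩
      funext i
      refine Ideal.Quotient.eq_zero_iff_mem.mpr (Ideal.mem_span_singleton.mpr ⟨r y i, ?_⟩)
      apply hinj
      rw [map_mul, hr, hr]
      change c.repr (algebraMap v.Completion w.place.Completion
        (algebraMap K v.Completion v.unif) * (y : w.place.Completion)) i = _
      rw [← Algebra.smul_def, map_smul]
      rfl
  have hcard : Nat.card (w.place.integers ⧸ Ideal.span {u'}) =
      Nat.card (v.integers ⧸ Ideal.span {u}) ^ finrank v.Completion w.place.Completion := by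
    have h1 : Nat.card (w.place.integers ⧸ Ideal.span {u'}) =
      (Ideal.span {u'}).toAddSubgroup.index := rfl
    rw [h1, ← hker, AddSubgroup.index_ker, AddMonoidHom.range_eq_top.mpr hsurj,
      AddSubgroup.card_top, Nat.card_fun, Nat.card_fin]
  have h1 := w.place.natCard_quotient_span_singleton hu0'
  have h2 := v.natCard_quotient_span_singleton (x := u) fun h => hu0 (congrArg Subtype.val h)
  rw [v.absVal_unif, inv_inv] at h2
  rw [← inv_inj, ← h1, hcard, Nat.cast_pow, h2, inv_inv]

/-- The normalized absolute value of `L_w` is that of `K_v` applied to the norm. -/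
lemma absVal_norm (w : Over v L) (x : w.place.Completion) :
    v.absVal (Algebra.norm v.Completion x) = w.place.absVal x := by
  obtain ⟨c, hc⟩ := w.exists_isIntegralBasis
  have hnorm0 : Algebra.norm v.Completion (0 : w.place.Completion) = 0 :=
    Algebra.norm_eq_zero_iff.mpr rfl
  let f : w.place.Completion →*₀ ℝ :=
    { (v.absValHom : v.Completion →* ℝ).comp (Algebra.norm v.Completion) with
      map_zero' := by
        change v.absVal (Algebra.norm v.Completion (0 : w.place.Completion)) = 0
        rw [hnorm0, absVal_zero] }
  have hf : ∀ x, f x = v.absVal (Algebra.norm v.Completion x) := fun _ => rfl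
  rcases eq_or_ne x 0 with rfl | hx
  · rw [hnorm0, absVal_zero, absVal_zero]
  have hint : ∀ y ∈ w.place.integers, Valued.v (Algebra.norm v.Completion y) ≤ 1 := by
    intro y hy
    obtain ⟨a, ha⟩ := hc.norm_mem hy
    rw [← ha]
    exact a.2
  -- The norms of a unit and of its inverse are both integral, so both functions are trivial on
  -- units and are determined by their value at a uniformizer of `w`.
  have hunit : ∀ y : w.place.Completion, Valued.v y = 1 → f y = 1 := by
    intro y hy
    rw [hf, absVal_eq_one_iff]
    have hy0 : y ≠ 0 := by
      rintro rfl
      simp at hy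
    refine le_antisymm (hint y hy.le) ?_
    have h1 := hint y⁻¹ (by rw [mem_integers_iff, map_inv₀, hy, inv_one])
    have h2 : Valued.v (Algebra.norm v.Completion y) *
        Valued.v (Algebra.norm v.Completion y⁻¹) = 1 := by
      rw [← map_mul, ← map_mul, mul_inv_cancel₀ hy0, map_one, map_one]
    calc 1 = _ := h2.symm
      _ ≤ Valued.v (Algebra.norm v.Completion y) * 1 := by gcongr
      _ = _ := mul_one _
  set π := algebraMap L w.place.Completion w.place.unif
  have hπ : π ≠ 0 := by simpa [π] using w.place.unif_ne_zero
  have hpow : ∀ y : w.place.Completion, y ≠ 0 → ∃ k : ℤ, f y = f π ^ k ∧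
      w.place.absVal y = w.place.absVal π ^ k := by
    intro y hy
    obtain ⟨k, hk⟩ := w.place.exists_zpow_unif hy
    refine ⟨k, ?_, ?_⟩
    · have h1 : f (y / π ^ k) = 1 := hunit _ (by
        rw [map_div₀, hk, div_self ((Valuation.ne_zero_iff _).mpr (zpow_ne_zero k hπ))])
      have h2 : y = y / π ^ k * π ^ k := (div_mul_cancel₀ _ (zpow_ne_zero k hπ)).symm
      rw [h2, map_mul, h1, one_mul, map_zpow₀]
    · rw [w.place.absVal_congr hk]
      exact map_zpow₀ w.place.absValHom π k
  -- The uniformizer of `v` is a unit times `π ^ k` with `k ≠ 0`, and the two functions agree on it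
  -- by `absVal_unif`. As their values at `π` are non-negative reals with equal `k`-th powers, they
  -- coincide.
  have key : f π = w.place.absVal π := by
    have hu0 : algebraMap v.Completion w.place.Completion
        (algebraMap K v.Completion v.unif) ≠ 0 := by simpa using v.unif_ne_zero
    obtain ⟨k, h1, h2⟩ := hpow _ hu0
    rw [hf, Algebra.norm_algebraMap, absVal_pow, v.absVal_unif, inv_pow, ← w.absVal_unif, h2] at h1
    have hk : k ≠ 0 := by
      rintro rfl
      rw [w.absVal_unif, zpow_zero, inv_eq_one, pow_eq_one_iff_of_nonneg (by positivity)
        (finrank_pos).ne'] at h2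
      have := v.one_lt_residueCard
      have h3 : v.residueCard = 1 := by exact_mod_cast h2
      omega
    have hp1 : 0 < f π := v.absVal_pos (by
      rw [Ne, Algebra.norm_eq_zero_iff]
      exact hπ)
    exact ((zpow_left_inj₀ hp1.le (w.place.absVal_nonneg _) hk).mp h1.symm)
  obtain ⟨k, h1, h2⟩ := hpow x hx
  rw [← hf, h1, h2, key]

/-- An integral basis of `L_w` over `K_v` computes the discriminant ideal. -/
lemma exists_isIntegralBasis_localDisc (w : Over v L) :
    ∃ (c : Basis (Fin (finrank v.Completion w.1.Completion)) v.Completion w.1.Completion)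
      (d : v.integers), IsIntegralBasis v.integers (w.1.integers.toSubring : Set w.1.Completion) c ∧
      (d : v.Completion) = Algebra.discr v.Completion c ∧ d ≠ 0 ∧ w.localDisc = Ideal.span {d} := by
  have := Fintype.ofFinite (Over v L)
  obtain ⟨D, -, -, h, -⟩ := v.exists_globalDiscriminantAt_eq (L := L)
  obtain ⟨d', hd0', hd'⟩ := h w
  obtain ⟨c, hc⟩ := w.exists_isIntegralBasis
  obtain ⟨d, hd⟩ := hc.discr_mem
  have h1 : w.localDisc = Ideal.span {d} := hc.discriminantIdeal_eq hd
  refine ⟨c, d, hc, hd, ?_, h1⟩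
  rintro rfl
  rw [hd'] at h1
  exact hd0' (Ideal.span_singleton_eq_bot.mp (h1.trans (Ideal.span_singleton_eq_bot.mpr rfl)))

/-- The local discriminants in a tower. -/
theorem idealNorm_localDisc_trans {Q : Type*} [Field Q] [Algebra Q K] [Algebra Q L]
    [IsScalarTower Q K L] [FiniteDimensional Q K] [Algebra.IsSeparable Q K] [FiniteDimensional Q L]
    [Algebra.IsSeparable Q L] {u : FinPlace Q} (v : Over u K) (w : Over v.place L) :
    idealNorm (v.trans w).localDisc = idealNorm w.localDisc *
      idealNorm v.localDisc ^ finrank v.place.Completion w.place.Completion := by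
  obtain ⟨b, d, hb, hbd, hd0, hd⟩ := v.exists_isIntegralBasis_localDisc
  obtain ⟨c, e, hc, hce, he0, he⟩ := w.exists_isIntegralBasis_localDisc
  obtain ⟨f, hf⟩ := hb.norm_mem e.2
  let _ : Algebra u.Completion w.place.Completion :=
    inferInstanceAs (Algebra u.Completion (v.trans w).place.Completion)
  have htower : IsScalarTower u.Completion v.place.Completion w.place.Completion :=
    IsScalarTower.of_algebraMap_eq (v.trans_algebraMap w)
  have hbc : IsIntegralBasis u.integers (w.place.integers : Set w.place.Completion)
      (b.smulTower' c) := by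
    refine hb.smulTower' hc ?_ ?_
    · rintro _ ⟨x, rfl⟩
      exact x.2
    · intro x hx y hy
      rw [Algebra.smul_def]
      exact mul_mem (w.algebraMap_mem_integers hx) hy
  have hdisc : algebraMap u.integers u.Completion
      (d ^ finrank v.place.Completion w.place.Completion * f) =
      Algebra.discr u.Completion (b.smulTower' c) := by
    rw [discr_smulTower', Fintype.card_fin, ← hbd, ← hce, map_mul, map_pow, hf]
    rfl
  have hf' : (f : u.Completion) = Algebra.norm u.Completion (e : v.place.Completion) := hf
  -- This turns the norm factor of the tower formula into the absolute norm of the upper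
  -- discriminant, now computed in `O_{K_v}`.
  have habs : u.absVal f = v.place.absVal e := by rw [hf', absVal_norm]
  have he0' : (e : v.place.Completion) ≠ 0 := fun h => he0 (Subtype.ext h)
  have hf0 : f ≠ 0 := by
    rintro rfl
    have := v.place.absVal_pos he0'
    rw [← habs] at this
    exact this.ne' u.absVal_zero
  have hspan : (v.trans w).localDisc =
      Ideal.span {d ^ finrank v.place.Completion w.place.Completion * f} :=
    hbc.discriminantIdeal_eq hdisc
  rw [hspan, he, hd, idealNorm_span_singleton _ (mul_ne_zero (pow_ne_zero _ hd0) hf0),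
    idealNorm_span_singleton _ hd0, idealNorm_span_singleton _ he0, ← habs]
  change (u.absVal ((d : u.Completion) ^ _ * (f : u.Completion)))⁻¹ = _
  rw [absVal_mul, absVal_pow, mul_inv, inv_pow, mul_comm]

end Over

end FinPlace

end AdelicRR

/-! ### Products of discriminants over all places. -/

namespace AdelicRR

open Module FinPlace

/-- A finitely supported product over the places of `L` can be taken over the fibres. -/
lemma finprod_finPlace_eq (K : Type*) {L : Type*} [Field K] [Field L] [Algebra K L]
    [Algebra.IsAlgebraic K L] (g : FinPlace L → ℝ) (hg : g.mulSupport.Finite) :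
    ∏ᶠ w, g w = ∏ᶠ v : FinPlace K, ∏ᶠ w : Over v L, g w.place := by
  classical
  have hinner : ∀ v : FinPlace K, ∏ᶠ w : Over v L, g w.place =
      ∏ w ∈ hg.toFinset with w.below K = v, g w := by
    intro v
    rw [← finprod_mem_range (f := g) (g := Over.place) fun _ _ h => Over.ext h]
    refine finprod_mem_eq_prod_of_inter_mulSupport_eq _ ?_
    ext w
    simp only [Set.mem_inter_iff, Set.mem_range, Finset.coe_filter, Set.Finite.mem_toFinset,
      Set.mem_ofPred_eq]
    constructor
    · rintro ⟨⟨w, rfl⟩, h⟩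
      exact ⟨⟨h, w.below_eq⟩, h⟩
    · rintro ⟨⟨h, h'⟩, -⟩
      exact ⟨⟨⟨w, h'⟩, rfl⟩, h⟩
  rw [finprod_eq_prod _ hg,
    finprod_eq_prod_of_mulSupport_subset (s := hg.toFinset.image (FinPlace.below K))]
  · simp_rw [hinner]
    exact (Finset.prod_fiberwise_of_maps_to (fun w hw => Finset.mem_image_of_mem _ hw) g).symm
  · intro v hv
    rw [Function.mem_mulSupport, hinner] at hv
    obtain ⟨w, hw, -⟩ := Finset.exists_ne_one_of_prod_ne_one hv
    rw [Finset.mem_filter] at hw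
    simp only [Finset.coe_image, Set.mem_image]
    exact ⟨w, hw.1, hw.2⟩

section LocalGlobal

section Algebraic

variable (K : Type*) {L : Type*} [Field K] [Field L] [Algebra K L] [Algebra.IsAlgebraic K L]

/-- The norm of the local relative discriminant. -/
def discNorm (w : FinPlace L) : ℝ := idealNorm (localDiscriminant K w)

/-- The local degree `[L_w : K_v]` at a place `w` above `v`. -/
def FinPlace.Over.degree {v : FinPlace K} (w : Over v L) : ℕ :=
  finrank v.Completion w.place.Completion

/-- The local degree `[L_w : K_v]` for the place `v` of `K` below `w`. -/
def localDegree (w : FinPlace L) : ℕ := (⟨w, rfl⟩ : Over (w.below K) L).degree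

variable {K}

lemma discNorm_place {v : FinPlace K} (w : Over v L) :
    discNorm K w.place = idealNorm w.localDisc := w.idealNorm_localDiscriminant

lemma localDegree_place {v : FinPlace K} (w : Over v L) :
    localDegree K w.place = w.degree := by
  obtain ⟨w, rfl⟩ := w
  rfl

end Algebraic

variable (K : Type*) {L : Type*} [Field K] [Field L] [Algebra K L] [FiniteDimensional K L]
  [Algebra.IsSeparable K L]

lemma one_le_discNorm (w : FinPlace L) : 1 ≤ discNorm K w :=
  (⟨w, rfl⟩ : Over (w.below K) L).one_le_idealNorm_localDisc

lemma discNorm_pos (w : FinPlace L) : 0 < discNorm K w := one_pos.trans_le (one_le_discNorm K w)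

lemma finprod_localDegree (v : FinPlace K) :
    ∑ᶠ w : Over v L, localDegree K w.place = finrank K L := by
  have := Fintype.ofFinite (Over v L)
  rw [finsum_eq_sum_of_fintype, ← sum_finrank_completion v]
  exact Finset.sum_congr rfl fun w _ => localDegree_place w

lemma exists_globalDiscriminantAt (v : FinPlace K) : ∃ D : v.ring, D ≠ 0 ∧
    globalDiscriminantAt K L v = Ideal.span {D} ∧
      (v.absVal (algebraMap K v.Completion D))⁻¹ = ∏ᶠ w : Over v L, discNorm K w.place := by
  have := Fintype.ofFinite (Over v L)
  obtain ⟨D, h1, h2, -, h3⟩ := v.exists_globalDiscriminantAt_eq (L := L)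
  refine ⟨D, h1, h2, ?_⟩
  rw [h3, finprod_eq_prod_of_fintype]
  exact Finset.prod_congr rfl fun w _ => (discNorm_place w).symm

lemma finite_setOf_not_subset_ring [GlobalField L] (x : L) :
    {v : FinPlace K | ¬ IsIntegral v.ring x}.Finite := by
  refine ((finite_setOf_notMem x).image (FinPlace.below K)).subset fun v hv => ?_
  rw [Set.mem_ofPred_eq, isIntegral_iff] at hv
  push Not at hv
  obtain ⟨w, hw⟩ := hv
  exact ⟨w.place, hw, w.below_eq⟩

/-- The global relative discriminant is trivial at all but finitely many places. -/
lemma finite_globalDiscriminantAt_ne_top [GlobalField K] [GlobalField L] :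
    {v : FinPlace K | globalDiscriminantAt K L v ≠ ⊤}.Finite := by
  classical
  let c := Module.finBasis K L
  have hc0 := Algebra.discr_not_zero_of_basis K c
  refine ((Set.finite_iUnion fun i => finite_setOf_not_subset_ring K (c i)).union
    ((finite_setOf_notMem (Algebra.discr K c)).union
      (finite_setOf_notMem (Algebra.discr K c)⁻¹))).subset fun v hv => ?_
  by_contra h
  simp only [Set.mem_union, Set.mem_iUnion, Set.mem_ofPred_eq, not_or, not_exists, not_not] at h
  obtain ⟨h1, h2, h3⟩ := h
  apply hv
  -- Away from the poles of the basis `c`, of its discriminant and of the inverse, that discriminant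
  -- is a unit in the ideal.
  refine Ideal.eq_top_of_isUnit_mem _ (x := (⟨_, h2⟩ : v.ring)) (Ideal.subset_span ⟨c, h1, rfl⟩) ?_
  exact IsUnit.of_mul_eq_one ⟨_, h3⟩ (Subtype.ext (mul_inv_cancel₀ hc0))

/-- The local norms above `v` are at least `1` and their product is `1`. -/
lemma discNorm_eq_one_of_globalDiscriminantAt {v : FinPlace K}
    (h : globalDiscriminantAt K L v = ⊤) (w : Over v L) : discNorm K w.place = 1 := by
  classical
  have := Fintype.ofFinite (Over v L)
  obtain ⟨D, h1, h2, h3⟩ := exists_globalDiscriminantAt K (L := L) v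
  rw [h, eq_comm, Ideal.span_singleton_eq_top] at h2
  have h4 : v.absVal (algebraMap K v.Completion D) = 1 :=
    v.absVal_unit _ (h2.map (algebraMap v.ring v.integers))
  rw [h4, inv_one, finprod_eq_prod_of_fintype] at h3
  refine le_antisymm ?_ (one_le_discNorm K _)
  rw [h3, ← Finset.mul_prod_erase _ _ (Finset.mem_univ w)]
  refine le_mul_of_one_le_right (discNorm_pos K _).le ?_
  rw [← Finset.prod_const_one (s := Finset.univ.erase w)]
  exact Finset.prod_le_prod (fun _ _ => zero_le_one) fun w _ => one_le_discNorm K w.place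

lemma finite_mulSupport_discNorm [GlobalField K] [GlobalField L] :
    (discNorm K : FinPlace L → ℝ).mulSupport.Finite := by
  refine ((finite_globalDiscriminantAt_ne_top K (L := L)).biUnion
    fun v _ => Set.finite_range (Over.place : Over v L → FinPlace L)).subset fun w hw => ?_
  refine Set.mem_biUnion (x := w.below K) (fun h => hw ?_) ⟨⟨w, rfl⟩, rfl⟩
  exact discNorm_eq_one_of_globalDiscriminantAt K h ⟨w, rfl⟩

/-- The existence of discriminant ideles. -/
theorem exists_isDiscriminantIdele [GlobalField K] [GlobalField L] :
    ∃ κ : (Adele K)ˣ, IsDiscriminantIdele K L κ := by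
  choose D hD0 hD _ using fun v => exists_globalDiscriminantAt K (L := L) v
  have hD0' : ∀ v, algebraMap K v.Completion (D v) ≠ 0 := fun v h => hD0 v (Subtype.ext (by
    simpa using h))
  have hfin := finite_globalDiscriminantAt_ne_top K (L := L)
  have h1 : ∀ᶠ v : FinPlace K in Filter.cofinite,
      algebraMap K v.Completion (D v) ∈ (v.integers : Set v.Completion) :=
    Filter.Eventually.of_forall fun v => (v.algebraMap_mem_integers_iff _).mpr (D v).2
  have h2 : ∀ᶠ v : FinPlace K in Filter.cofinite,
      (algebraMap K v.Completion (D v))⁻¹ ∈ (v.integers : Set v.Completion) := by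
    filter_upwards [hfin.compl_mem_cofinite] with v hv
    have hv' : globalDiscriminantAt K L v = ⊤ := not_not.mp hv
    rw [hD, Ideal.span_singleton_eq_top] at hv'
    obtain ⟨e, he⟩ := hv'.exists_right_inv
    have he' : (D v : K) * (e : K) = 1 := congrArg Subtype.val he
    rw [← map_inv₀, ← eq_inv_of_mul_eq_one_right he']
    exact (v.algebraMap_mem_integers_iff _).mpr e.2
  let x : FiniteAdele K := ⟨fun v => algebraMap K v.Completion (D v), h1⟩
  let y : FiniteAdele K := ⟨fun v => (algebraMap K v.Completion (D v))⁻¹, h2⟩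
  have hxy : x * y = 1 := by
    refine RestrictedProduct.ext _ _ fun v => ?_
    exact mul_inv_cancel₀ (hD0' v)
  refine ⟨⟨(1, x), (1, y), ?_, ?_⟩, fun v => ?_, fun v => ?_⟩
  · rw [Prod.mk_mul_mk, hxy, one_mul]
    rfl
  · rw [Prod.mk_mul_mk, mul_comm y x, hxy, one_mul]
    rfl
  · change ‖(1 : v.Completion)‖ ^ v.mult = 1
    simp
  · refine ⟨algebraMap v.ring v.integers (D v), rfl, ?_⟩
    rw [hD, Ideal.map_span, Set.image_singleton]

lemma absVal_discriminantIdele {κ : (Adele K)ˣ} (hκ : IsDiscriminantIdele K L κ) (v : FinPlace K) :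
    v.absVal (κ.val.2 v) = (∏ᶠ w : Over v L, discNorm K w.place)⁻¹ := by
  obtain ⟨D, hD0, hD, h⟩ := exists_globalDiscriminantAt K (L := L) v
  obtain ⟨x, hx, hspan⟩ := hκ.2 v
  rw [hD, Ideal.map_span, Set.image_singleton, Ideal.span_singleton_eq_span_singleton] at hspan
  obtain ⟨a, ha⟩ := hspan
  have h1 : algebraMap K v.Completion D = (x : v.Completion) * ((a : v.integers) : v.Completion) :=
    congrArg Subtype.val ha.symm
  rw [← h, inv_inv, h1, absVal_mul, v.absVal_unit _ a.isUnit, mul_one, hx]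

/-- The absolute value of a discriminant idele. -/
theorem ideleAbs_discriminantIdele [GlobalField K] [GlobalField L] {κ : (Adele K)ˣ}
    (hκ : IsDiscriminantIdele K L κ) :
    ideleAbs κ = (∏ᶠ w : FinPlace L, discNorm K w)⁻¹ := by
  rw [ideleAbs, finprod_congr hκ.1, finprod_one, one_mul,
    finprod_congr (absVal_discriminantIdele K hκ), finprod_inv_distrib,
    ← finprod_finPlace_eq K _ (finite_mulSupport_discNorm K)]

end LocalGlobal

section Tower

variable {Q K L : Type*} [Field Q] [Field K] [Field L] [Algebra Q K] [Algebra K L] [Algebra Q L]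
  [IsScalarTower Q K L] [FiniteDimensional Q K] [Algebra.IsSeparable Q K] [FiniteDimensional Q L]
  [Algebra.IsSeparable Q L] [FiniteDimensional K L] [Algebra.IsSeparable K L]

lemma discNorm_tower (w : FinPlace L) :
    discNorm Q w = discNorm K w * discNorm Q (w.below K) ^ localDegree K w := by
  let v' : Over ((w.below K).below Q) K := ⟨w.below K, rfl⟩
  let w' : Over v'.place L := ⟨w, rfl⟩
  have h := Over.idealNorm_localDisc_trans v' w'
  rw [← discNorm_place, ← discNorm_place, ← discNorm_place] at h
  exact h

variable (Q K L) in
/-- The product formula for discriminants in a tower. -/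
theorem finprod_discNorm_tower [GlobalField Q] [GlobalField K] [GlobalField L] :
    ∏ᶠ w : FinPlace L, discNorm Q w =
      (∏ᶠ w : FinPlace L, discNorm K w) * (∏ᶠ v : FinPlace K, discNorm Q v) ^ finrank K L := by
  have h1 := finite_mulSupport_discNorm Q (L := L)
  have h2 := finite_mulSupport_discNorm K (L := L)
  -- By the local tower formula this factor is `1` wherever the other two are.
  have h3 : (fun w : FinPlace L => discNorm Q (w.below K) ^ localDegree K w).mulSupport.Finite := by
    refine ((h1.union h2)).subset fun w hw => ?_
    by_contra h
    simp only [Set.mem_union, Function.mem_mulSupport, not_or, not_not] at h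
    have := discNorm_tower (Q := Q) (K := K) w
    rw [h.1, h.2, one_mul] at this
    exact hw this.symm
  rw [finprod_congr (discNorm_tower (Q := Q) (K := K)), finprod_mul_distrib h2 h3, finprod_finPlace_eq K _ h3,
    finprod_pow (finite_mulSupport_discNorm Q)]
  congr 1
  refine finprod_congr fun v => ?_
  have := Fintype.ofFinite (Over v L)
  rw [finprod_eq_prod_of_fintype, ← finprod_localDegree (L := L) K v, finsum_eq_sum_of_fintype,
    ← Finset.prod_pow_eq_pow_sum]
  refine Finset.prod_congr rfl fun w _ => ?_
  rw [w.below_eq]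

end Tower

end AdelicRR

/-! ### Haar measure on the finite adeles and its scaling by ideles. -/

namespace AdelicRR

open FinPlace
open scoped Pointwise

/-- The index formula for `H` inside `K`, applied to the invariant measure that `μ` induces on `K`.
-/
lemma relIndex_mul_measure {G : Type*} [AddGroup G] [MeasurableSpace G] [MeasurableAdd G]
    (μ : Measure G) [μ.IsAddLeftInvariant] {H K : AddSubgroup G} (h : H ≤ K)
    (hH : MeasurableSet (H : Set G)) (hK : MeasurableSet (K : Set G)) (hHK : H.relIndex K ≠ 0) :
    (H.relIndex K : ENNReal) * μ H = μ K := by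
  have hemb : MeasurableEmbedding (K.subtype : K → G) := MeasurableEmbedding.subtype_coe hK
  have : MeasurableAdd K := {
    measurable_const_add := fun c => Measurable.subtype_mk
      ((measurable_const_add (c : G)).comp measurable_subtype_coe)
    measurable_add_const := fun c => Measurable.subtype_mk
      ((measurable_add_const (c : G)).comp measurable_subtype_coe) }
  have hinv : (μ.comap K.subtype).IsAddLeftInvariant :=
    Measure.IsAddLeftInvariant.comap μ hemb
  have : (H.addSubgroupOf K).FiniteIndex := ⟨hHK⟩
  have key := AddSubgroup.index_mul_measure (H.addSubgroupOf K)
    (measurable_subtype_coe hH) (μ.comap K.subtype)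
  rw [hemb.comap_apply, hemb.comap_apply] at key
  have h1 : (K.subtype '' (H.addSubgroupOf K : Set K)) = H := by
    ext x
    constructor
    · rintro ⟨y, hy, rfl⟩
      exact hy
    · intro hx
      exact ⟨⟨x, h hx⟩, hx, rfl⟩
  have h2 : (K.subtype '' Set.univ) = K := by simp
  rw [h1, h2] at key
  exact key

section FiniteIdeles

variable {L : Type*} [Field L]

lemma finiteAdele_mul_apply (x y : FiniteAdele L) (w : FinPlace L) : (x * y) w = x w * y w := rfl

lemma finiteAdele_one_apply (w : FinPlace L) : (1 : FiniteAdele L) w = 1 := rfl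

lemma finiteIdele_mul_inv (α : (FiniteAdele L)ˣ) (w : FinPlace L) :
    α.val w * α⁻¹.val w = 1 := by
  rw [← finiteAdele_mul_apply, Units.mul_inv, finiteAdele_one_apply]

lemma finiteIdele_ne_zero (α : (FiniteAdele L)ˣ) (w : FinPlace L) : α.val w ≠ 0 :=
  left_ne_zero_of_mul_eq_one (finiteIdele_mul_inv α w)

lemma finiteIdele_inv_apply (α : (FiniteAdele L)ˣ) (w : FinPlace L) :
    α⁻¹.val w = (α.val w)⁻¹ := eq_inv_of_mul_eq_one_right (finiteIdele_mul_inv α w)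

lemma absVal_le_one_iff (w : FinPlace L) {x : w.Completion} (hx : x ≠ 0) :
    w.absVal x ≤ 1 ↔ x ∈ w.integers := by
  rw [w.mem_integers_iff, w.absVal_of_ne_zero hx, zpow_le_one_iff_right₀
    (by exact_mod_cast w.one_lt_residueCard), WithZero.log_le_iff_le_exp (by simpa using hx)]
  rfl

lemma finite_mulSupport_absVal (α : (FiniteAdele L)ˣ) :
    (fun w : FinPlace L => w.absVal (α.val w)).mulSupport.Finite := by
  have h1 := Filter.eventually_cofinite.mp α.val.2
  have h2 := Filter.eventually_cofinite.mp α⁻¹.val.2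
  refine (h1.union h2).subset fun w hw => ?_
  by_contra h
  simp only [Set.mem_union, Set.mem_ofPred_eq, not_or, not_not] at h
  refine hw (le_antisymm ((absVal_le_one_iff w (finiteIdele_ne_zero α w)).mpr h.1) ?_)
  have := (absVal_le_one_iff w (finiteIdele_ne_zero α⁻¹ w)).mpr h.2
  rw [finiteIdele_inv_apply, absVal_inv] at this
  exact (inv_le_one₀ (w.absVal_pos (finiteIdele_ne_zero α w))).mp this

open scoped Classical in
/-- The finite idele with component `x` at `w` and `1` elsewhere. -/
def singleIdele (w : FinPlace L) : w.Completionˣ →* (FiniteAdele L)ˣ :=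
  Units.map
    { toFun := RestrictedProduct.mulSingle (fun v : FinPlace L => v.integers) w
      map_one' := RestrictedProduct.mulSingle_one _ _
      map_mul' := fun x y => by
        ext v
        simp [Pi.mulSingle_mul] }

open scoped Classical in
lemma singleIdele_same (w : FinPlace L) (x : w.Completionˣ) : (singleIdele w x).val w = x :=
  Pi.mulSingle_eq_same (M := fun v : FinPlace L => v.Completion) w (x : w.Completion)

open scoped Classical in
lemma singleIdele_of_ne {w v : FinPlace L} (h : v ≠ w) (x : w.Completionˣ) :
    (singleIdele w x).val v = 1 :=
  Pi.mulSingle_eq_of_ne (M := fun v : FinPlace L => v.Completion) h (x : w.Completion)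

variable (L) in
/-- The additive group of integral finite adeles. -/
def integralAddSubgroup : AddSubgroup (FiniteAdele L) where
  carrier := integralFiniteAdeles L
  zero_mem' := fun _ => zero_mem _
  add_mem' := fun hx hy w => add_mem (hx w) (hy w)
  neg_mem' := fun hx w => neg_mem (hx w)

lemma mem_smul_integral {α : (FiniteAdele L)ˣ} {x : FiniteAdele L} :
    x ∈ α • (integralFiniteAdeles L : Set (FiniteAdele L)) ↔
      ∀ w, (α.val w)⁻¹ * x w ∈ w.integers := by
  rw [Set.mem_smul_set_iff_inv_smul_mem]
  refine forall_congr' fun w => ?_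
  rw [Units.smul_def, smul_eq_mul, finiteAdele_mul_apply, finiteIdele_inv_apply]

variable (L) in
/-- The Haar measure on the finite adeles with total mass one on the integral adeles. -/
def finiteHaar : Measure (FiniteAdele L) := Measure.addHaarMeasure (integralFiniteAdeles L)

instance : (finiteHaar L).IsAddHaarMeasure :=
  Measure.isAddHaarMeasure_addHaarMeasure _

instance : (finiteHaar L).Regular := Measure.regular_addHaarMeasure

lemma finiteHaar_integral : finiteHaar L (integralFiniteAdeles L : Set (FiniteAdele L)) = 1 :=
  Measure.addHaarMeasure_self

lemma measurableSet_smul_integral (α : (FiniteAdele L)ˣ) :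
    MeasurableSet (α • (integralFiniteAdeles L : Set (FiniteAdele L))) :=
  ((integralFiniteAdeles L).isCompact.smul α).measurableSet

lemma finiteHaar_smul (α : (FiniteAdele L)ˣ) :
    finiteHaar L (α • (integralFiniteAdeles L : Set (FiniteAdele L))) =
      distribHaarChar (FiniteAdele L) α := by
  rw [← distribHaarChar_mul, finiteHaar_integral, mul_one]

/-- Such an idele maps `∏ O_w`, a set of measure one, onto itself. -/
lemma distribHaarChar_of_absVal_eq_one {α : (FiniteAdele L)ˣ}
    (h : ∀ w : FinPlace L, w.absVal (α.val w) = 1) : distribHaarChar (FiniteAdele L) α = 1 := by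
  have h1 : α • (integralFiniteAdeles L : Set (FiniteAdele L)) = integralFiniteAdeles L := by
    ext x
    rw [mem_smul_integral]
    refine forall_congr' fun w => ?_
    have hw := w.absVal_eq_one_iff.mp (h w)
    rw [w.mem_integers_iff, w.mem_integers_iff, map_mul, map_inv₀, hw, inv_one, one_mul]
  have := finiteHaar_smul α
  rw [h1, finiteHaar_integral] at this
  exact_mod_cast this.symm

/-- Multiplication by this idele sends `∏ O_w` onto a subgroup with quotient `O_w / x`, so the
volume is divided by the number of elements of this quotient, which is `|x|_w⁻¹`. -/
lemma distribHaarChar_singleIdele_of_mem (w : FinPlace L) (x : w.Completionˣ)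
    (hx : (x : w.Completion) ∈ w.integers) :
    (distribHaarChar (FiniteAdele L) (singleIdele w x) : ℝ) = w.absVal x := by
  classical
  let a : w.integers := ⟨x, hx⟩
  have ha : a ≠ 0 := fun h => x.ne_zero (congrArg Subtype.val h)
  let f : integralAddSubgroup L →+ w.integers ⧸ Ideal.span {a} :=
    (Ideal.Quotient.mk (Ideal.span {a})).toAddMonoidHom.comp
      { toFun := fun y => ⟨y.1 w, y.2 w⟩
        map_zero' := rfl
        map_add' := fun _ _ => rfl }
  have hsurj : Function.Surjective f := by
    intro q
    obtain ⟨y, rfl⟩ := Ideal.Quotient.mk_surjective q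
    refine ⟨⟨RestrictedProduct.single (fun v : FinPlace L => v.integers) w (y : w.Completion),
      fun v => ?_⟩, ?_⟩
    · by_cases h : v = w
      · subst h
        rw [RestrictedProduct.single_eq_same]
        exact y.2
      · rw [RestrictedProduct.single_eq_of_ne _ _ h]
        exact zero_mem _
    · change Ideal.Quotient.mk _ _ = _
      congr 1
      exact Subtype.ext (RestrictedProduct.single_eq_same (fun v : FinPlace L => v.integers) w _)
  have hker : ((singleIdele w x) • integralAddSubgroup L).addSubgroupOf (integralAddSubgroup L) =
      f.ker := by
    ext y
    rw [AddSubgroup.mem_addSubgroupOf, AddMonoidHom.mem_ker]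
    change (y : FiniteAdele L) ∈
      (singleIdele w x) • (integralFiniteAdeles L : Set (FiniteAdele L)) ↔
      Ideal.Quotient.mk (Ideal.span {a}) ⟨y.1 w, y.2 w⟩ = 0
    rw [mem_smul_integral, Ideal.Quotient.eq_zero_iff_mem, Ideal.mem_span_singleton]
    constructor
    · intro h
      have hw := h w
      rw [singleIdele_same] at hw
      exact ⟨⟨_, hw⟩, Subtype.ext (mul_inv_cancel_left₀ x.ne_zero _).symm⟩
    · rintro ⟨c, hc⟩ v
      by_cases h : v = w
      · subst h
        have hc' : y.1 v = x * c := congrArg Subtype.val hc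
        rw [singleIdele_same, hc', inv_mul_cancel_left₀ x.ne_zero]
        exact c.2
      · rw [singleIdele_of_ne h, inv_one, one_mul]
        exact y.2 v
  have hle : (singleIdele w x) • integralAddSubgroup L ≤ integralAddSubgroup L := by
    intro y hy v
    have := mem_smul_integral.mp hy v
    by_cases h : v = w
    · subst h
      rw [singleIdele_same] at this
      simpa using mul_mem hx this
    · simpa [singleIdele_of_ne h] using this
  have hcard : (((singleIdele w x) • integralAddSubgroup L).relIndex (integralAddSubgroup L) : ℝ) =
      (w.absVal x)⁻¹ := by
    rw [AddSubgroup.relIndex, hker, AddSubgroup.index_ker, AddMonoidHom.range_eq_top.mpr hsurj,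
      AddSubgroup.card_top, w.natCard_quotient_span_singleton ha]
  have hpos := w.absVal_pos x.ne_zero
  have key := relIndex_mul_measure (finiteHaar L) hle (measurableSet_smul_integral _)
    (integralFiniteAdeles L).isCompact.measurableSet (by
      intro h
      rw [h, Nat.cast_zero] at hcard
      exact (inv_pos.mpr hpos).ne hcard)
  have e1 : finiteHaar L ((singleIdele w x) • integralAddSubgroup L : AddSubgroup _) =
      distribHaarChar (FiniteAdele L) (singleIdele w x) := finiteHaar_smul _
  have e2 : finiteHaar L (integralAddSubgroup L) = 1 := finiteHaar_integral
  rw [e1, e2] at key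
  have key' := congrArg ENNReal.toReal key
  rw [ENNReal.toReal_mul, ENNReal.toReal_natCast, hcard, ENNReal.toReal_one,
    inv_mul_eq_one₀ hpos.ne'] at key'
  exact key'.symm

lemma distribHaarChar_singleIdele (w : FinPlace L) (x : w.Completionˣ) :
    (distribHaarChar (FiniteAdele L) (singleIdele w x) : ℝ) = w.absVal x := by
  rcases w.integers.mem_or_inv_mem (x : w.Completion) with h | h
  · exact distribHaarChar_singleIdele_of_mem w x h
  · have := distribHaarChar_singleIdele_of_mem w x⁻¹ (by simpa using h)
    rw [map_inv, map_inv, Units.val_inv_eq_inv_val, absVal_inv, NNReal.coe_inv] at this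
    exact inv_injective this

/-- Multiplication by a finite idele scales the Haar measure by its absolute value. -/
lemma distribHaarChar_finiteIdele (α : (FiniteAdele L)ˣ) :
    (distribHaarChar (FiniteAdele L) α : ℝ) = ∏ᶠ w : FinPlace L, w.absVal (α.val w) := by
  classical
  have hfin := finite_mulSupport_absVal α
  let comp : ∀ w : FinPlace L, w.Completionˣ := fun w =>
    Units.mk0 (α.val w) (finiteIdele_ne_zero α w)
  -- `β` collects the finitely many components of absolute value other than `1`; the quotient `α *
  -- β⁻¹` does not change the measure.
  let β : (FiniteAdele L)ˣ := ∏ w ∈ hfin.toFinset, singleIdele w (comp w)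
  have hβ : ∀ v, β.val v = if v ∈ hfin.toFinset then α.val v else 1 := by
    intro v
    have h1 : β.val v = ∏ w ∈ hfin.toFinset, (singleIdele w (comp w)).val v := by
      let ev : (FiniteAdele L)ˣ →* v.Completion :=
        { toFun := fun x => x.val v, map_one' := rfl, map_mul' := fun _ _ => rfl }
      exact map_prod ev _ _
    rw [h1]
    split_ifs with hv
    · rw [Finset.prod_eq_single_of_mem v hv fun w _ hw => singleIdele_of_ne hw.symm _,
        singleIdele_same]
      rfl
    · exact Finset.prod_eq_one fun w hw => singleIdele_of_ne (by rintro rfl; exact hv hw) _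
  have hu : distribHaarChar (FiniteAdele L) (α * β⁻¹) = 1 := by
    refine distribHaarChar_of_absVal_eq_one fun w => ?_
    rw [Units.val_mul, finiteAdele_mul_apply, finiteIdele_inv_apply, absVal_mul, absVal_inv, hβ]
    split_ifs with hw
    · exact mul_inv_cancel₀ (w.absVal_pos (finiteIdele_ne_zero α w)).ne'
    · rw [absVal_one, inv_one, mul_one]
      simpa using hw
  have h2 : distribHaarChar (FiniteAdele L) α = distribHaarChar (FiniteAdele L) β := by
    have h3 := congrArg (· * distribHaarChar (FiniteAdele L) β) hu
    simpa only [← map_mul, inv_mul_cancel_right, one_mul] using h3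
  rw [h2, map_prod, NNReal.coe_prod, finprod_eq_prod _ hfin]
  exact Finset.prod_congr rfl fun w _ => distribHaarChar_singleIdele w _

lemma finprod_absVal_pos (α : (FiniteAdele L)ˣ) :
    0 < ∏ᶠ w : FinPlace L, w.absVal (α.val w) :=
  finprod_induction (0 < ·) one_pos (fun _ _ => mul_pos)
    fun w => w.absVal_pos (finiteIdele_ne_zero α w)

lemma finprod_finFactor (α : (FiniteAdele L)ˣ) (u : FiniteAdele L) :
    ∏ᶠ w : FinPlace L, finFactor w ((α.val w)⁻¹ * u w) =
      (α • (integralFiniteAdeles L : Set (FiniteAdele L))).indicator 1 u := by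
  classical
  by_cases hu : u ∈ α • (integralFiniteAdeles L : Set (FiniteAdele L))
  · rw [Set.indicator_of_mem hu]
    exact finprod_eq_one_of_forall_eq_one fun w =>
      Set.indicator_of_mem (mem_smul_integral.mp hu w) _
  · rw [Set.indicator_of_notMem hu]
    rw [mem_smul_integral, not_forall] at hu
    obtain ⟨w, hw⟩ := hu
    refine finprod_eq_zero _ w (Set.indicator_of_notMem hw _) ?_
    -- Finite support must be checked here: otherwise the `finprod` would take its default value `1`
    -- in spite of the zero factor.
    have h : ∀ᶠ v in Filter.cofinite, (α⁻¹.val * u) v ∈ v.integers := (α⁻¹.val * u).2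
    refine (Filter.eventually_cofinite.mp h).subset fun v hv => ?_
    rw [Function.mem_mulSupport] at hv
    intro hmem
    rw [finiteAdele_mul_apply, finiteIdele_inv_apply] at hmem
    exact hv (Set.indicator_of_mem hmem _)

end FiniteIdeles

end AdelicRR

/-! ### Countability and σ-finiteness; the finite part of the measure. -/

namespace AdelicRR

open FinPlace
open scoped Pointwise

section SigmaFinite

lemma countable_of_finiteDimensional (F E : Type*) [Field F] [Field E] [Algebra F E]
    [FiniteDimensional F E] [Countable F] : Countable E :=
  (Module.finBasis F E).equivFun.injective.countable

lemma GlobalField.countable (K : Type*) [Field K] [h : GlobalField K] : Countable K := by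
  rcases h.out with h | ⟨p, hp, hA, h1, -⟩
  · exact countable_of_finiteDimensional ℚ K
  · have hpoly : Countable (Polynomial (ZMod p)) := by
      have : Function.Injective (fun f : Polynomial (ZMod p) => f.toFinsupp.coeff) := fun f g h => by
        ext n
        exact DFunLike.congr_fun h n
      exact this.countable
    have : Countable (RatFunc (ZMod p)) := by
      have hs : Function.Surjective (fun q : Polynomial (ZMod p) × Polynomial (ZMod p) =>
          algebraMap _ (RatFunc (ZMod p)) q.1 / algebraMap _ (RatFunc (ZMod p)) q.2) := by
        intro x
        obtain ⟨a, b, -, rfl⟩ := IsFractionRing.div_surjective (A := Polynomial (ZMod p)) x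
        exact ⟨(a, b), rfl⟩
      exact hs.countable
    exact countable_of_finiteDimensional (RatFunc (ZMod p)) K

variable (L : Type*) [Field L] [GlobalField L]

/-- Every place is a pole of some element of the countable field `L`, and each element has finitely
many poles. -/
instance GlobalField.countable_finPlace : Countable (FinPlace L) := by
  have := GlobalField.countable L
  rw [← Set.countable_univ_iff]
  refine (Set.countable_iUnion fun x : L => (finite_setOf_notMem x).countable).mono fun w _ => ?_
  obtain ⟨x, hx⟩ := w.exists_notMem
  exact Set.mem_iUnion.mpr ⟨x, hx⟩

/-- Makes the Haar measure σ-finite, as Fubini's theorem requires. A finite adele is non-integral at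
finitely many places, where a high power of the uniformizer clears denominators. So countably many
multiples of `∏ O_w`, indexed by a finite set of places and an exponent, cover everything. -/
instance : SigmaCompactSpace (FiniteAdele L) := by
  classical
  let ϖ : ∀ w : FinPlace L, w.Completionˣ := fun w =>
    Units.mk0 (algebraMap L w.Completion w.unif) (by simpa using w.unif_ne_zero)
  let β : Finset (FinPlace L) × ℕ → (FiniteAdele L)ˣ := fun s =>
    ∏ w ∈ s.1, singleIdele w (ϖ w ^ s.2)
  have hβ : ∀ s v, (β s).val v = if v ∈ s.1 then (ϖ v : v.Completion) ^ s.2 else 1 := by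
    intro s v
    have h1 : (β s).val v = ∏ w ∈ s.1, (singleIdele w (ϖ w ^ s.2)).val v := by
      let ev : (FiniteAdele L)ˣ →* v.Completion :=
        { toFun := fun x => x.val v, map_one' := rfl, map_mul' := fun _ _ => rfl }
      exact map_prod ev _ _
    rw [h1]
    split_ifs with hv
    · rw [Finset.prod_eq_single_of_mem v hv fun w _ hw => singleIdele_of_ne hw.symm _,
        singleIdele_same, Units.val_pow_eq_pow_val]
    · exact Finset.prod_eq_one fun w hw => singleIdele_of_ne (by rintro rfl; exact hv hw) _
  rw [← isSigmaCompact_univ_iff]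
  have hcover : (Set.univ : Set (FiniteAdele L)) =
      ⋃ s, (β s)⁻¹ • (integralFiniteAdeles L : Set (FiniteAdele L)) := by
    refine (Set.eq_univ_of_forall fun x => ?_).symm
    have hfin := Filter.eventually_cofinite.mp x.2
    have hn : ∀ w : FinPlace L, ∃ n : ℕ, ∀ m, n ≤ m → (ϖ w : w.Completion) ^ m * x w ∈ w.integers := by
      intro w
      have hϖ : (ϖ w : w.Completion) ∈ w.integers := (w.algebraMap_mem_integers_iff _).mpr w.unif_mem
      by_cases hx : x w = 0
      · exact ⟨0, fun m _ => by rw [hx, mul_zero]; exact zero_mem _⟩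
      · obtain ⟨n, hn⟩ := w.exists_zpow_unif hx
        refine ⟨n.natAbs, fun m hm => ?_⟩
        rw [w.mem_integers_iff, map_mul, hn, ← map_mul]
        change Valued.v ((ϖ w : w.Completion) ^ m * (ϖ w : w.Completion) ^ n) ≤ 1
        rw [← zpow_natCast, ← zpow_add₀ (ϖ w).ne_zero,
          ← Int.toNat_of_nonneg (a := (m : ℤ) + n) (by omega), zpow_natCast]
        exact pow_mem hϖ _
    choose n hn using hn
    refine Set.mem_iUnion.mpr ⟨(hfin.toFinset, hfin.toFinset.sup n), ?_⟩
    rw [mem_smul_integral]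
    intro w
    rw [finiteIdele_inv_apply, inv_inv, hβ]
    split_ifs with hw
    · exact hn w _ (Finset.le_sup hw)
    · rw [one_mul]
      rw [Set.Finite.mem_toFinset, Set.mem_ofPred_eq, not_not] at hw
      exact hw
  rw [hcover]
  exact isSigmaCompact_iUnion_of_isCompact _ fun s => (integralFiniteAdeles L).isCompact.smul _

end SigmaFinite

section FiniteIntegral

variable (K L : Type*) [Field K] [Field L] [Algebra K L] [Algebra.IsAlgebraic K L]

lemma localRelMeasure_integers (w : FinPlace L) :
    localRelMeasure K w (w.integers : Set w.Completion) =
      ENNReal.ofReal (discNorm K w ^ (-(1 / 2) : ℝ)) := by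
  have h : Measure.addHaarMeasure w.integersCompacts (w.integers : Set w.Completion) = 1 :=
    Measure.addHaarMeasure_self (K₀ := w.integersCompacts)
  rw [localRelMeasure, Measure.smul_apply, h, smul_eq_mul, mul_one]
  rfl

variable [FiniteDimensional K L] [Algebra.IsSeparable K L]

lemma rpow_discNorm_pos (w : FinPlace L) : 0 < discNorm K w ^ (-(1 / 2) : ℝ) :=
  Real.rpow_pos_of_pos (discNorm_pos K w) _

/-- The finite part of the relative measure as a multiple of the normalized Haar measure. -/
lemma finiteRelMeasure_eq [GlobalField K] [GlobalField L] :
    finiteRelMeasure K L =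
      ENNReal.ofReal ((∏ᶠ w : FinPlace L, discNorm K w) ^ (-(1 / 2) : ℝ)) • finiteHaar L := by
  have hfin := finite_mulSupport_discNorm (L := L) K
  rw [finiteRelMeasure, finiteHaar]
  congr 1
  simp_rw [localRelMeasure_integers]
  rw [finprod_eq_prod _ hfin, finprod_eq_prod_of_mulSupport_subset (s := hfin.toFinset),
    ← ENNReal.ofReal_prod_of_nonneg fun w _ => (rpow_discNorm_pos K L w).le,
    Real.finsetProd_rpow _ _ fun w _ => (discNorm_pos K w).le]
  intro w hw
  rw [Set.Finite.coe_toFinset, Function.mem_mulSupport]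
  intro h
  exact hw (by simp only [h, Real.one_rpow, ENNReal.ofReal_one])

end FiniteIntegral

/-! ### Gaussian integrals at the archimedean places. -/

section ArchIntegral

variable {L : Type*} [Field L]

lemma archFactor_eq (w : InfinitePlace L) (x : w.Completion) :
    archFactor w x = Real.exp (-(w.mult * Real.pi) * ‖x‖ ^ 2) := by
  have h : archAbsVal w x ^ (2 / w.mult : ℝ) = ‖x‖ ^ 2 := by
    rw [archAbsVal, ← Real.rpow_natCast, ← Real.rpow_mul (norm_nonneg _),
      mul_div_cancel₀ _ (by exact_mod_cast w.mult_ne_zero)]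
    exact_mod_cast rfl
  rw [archFactor, h, neg_mul]

lemma norm_isometryEquivReal_symm {w : InfinitePlace L} (h : w.IsReal) (t : ℝ) :
    ‖(InfinitePlace.Completion.isometryEquivRealOfIsReal h).symm t‖ = ‖t‖ := by
  have h0 : (InfinitePlace.Completion.isometryEquivRealOfIsReal h).symm 0 = 0 :=
    map_zero (InfinitePlace.Completion.ringEquivRealOfIsReal h).symm
  rw [← dist_zero_right, ← h0, IsometryEquiv.dist_eq, dist_zero_right]

lemma norm_isometryEquivComplex_symm {w : InfinitePlace L} (h : w.IsComplex) (t : ℂ) :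
    ‖(InfinitePlace.Completion.isometryEquivComplexOfIsComplex h).symm t‖ = ‖t‖ := by
  have h0 : (InfinitePlace.Completion.isometryEquivComplexOfIsComplex h).symm 0 = 0 :=
    map_zero (InfinitePlace.Completion.ringEquivComplexOfIsComplex h).symm
  rw [← dist_zero_right, ← h0, IsometryEquiv.dist_eq, dist_zero_right]

instance sigmaFinite_archMeasure (w : InfinitePlace L) : SigmaFinite (archMeasure w) := by
  rw [archMeasure]
  split_ifs with h
  · exact (InfinitePlace.Completion.isometryEquivRealOfIsReal
      h).symm.toHomeomorph.toMeasurableEquiv.sigmaFinite_map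
  · have := (InfinitePlace.Completion.isometryEquivComplexOfIsComplex
      (InfinitePlace.not_isReal_iff_isComplex.mp h)).symm.toHomeomorph.toMeasurableEquiv.sigmaFinite_map
      (μ := volume)
    change SigmaFinite (Measure.map (InfinitePlace.Completion.isometryEquivComplexOfIsComplex
      (InfinitePlace.not_isReal_iff_isComplex.mp h)).symm volume) at this
    rw [two_smul]
    infer_instance

/-- The Gaussian integral at an archimedean place. -/
lemma integral_archFactor (w : InfinitePlace L) {a : w.Completion} (ha : a ≠ 0) :
    Integrable (fun x => archFactor w (a⁻¹ * x)) (archMeasure w) ∧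
      ∫ x, archFactor w (a⁻¹ * x) ∂(archMeasure w) = archAbsVal w a := by
  have ha' : 0 < ‖a‖ := norm_pos_iff.mpr ha
  -- A non-integrable function has Bochner integral zero, so the non-zero value already yields
  -- integrability.
  suffices h : ∫ x, archFactor w (a⁻¹ * x) ∂(archMeasure w) = archAbsVal w a by
    refine ⟨Integrable.of_integral_ne_zero ?_, h⟩
    rw [h]
    exact (pow_pos ha' _).ne'
  have hf : ∀ x, archFactor w (a⁻¹ * x) =
      Real.exp (-(w.mult * Real.pi * (‖a‖ ^ 2)⁻¹) * ‖x‖ ^ 2) := by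
    intro x
    rw [archFactor_eq, norm_mul, norm_inv]
    ring_nf
  simp_rw [hf, archAbsVal]
  by_cases h : w.IsReal
  · have he := (InfinitePlace.Completion.isometryEquivRealOfIsReal
      h).symm.toHomeomorph.measurableEmbedding
    rw [IsometryEquiv.coe_toHomeomorph] at he
    rw [archMeasure, dif_pos h, he.integral_map]
    simp_rw [norm_isometryEquivReal_symm, Real.norm_eq_abs, sq_abs,
      InfinitePlace.mult, if_pos h, Nat.cast_one, one_mul, pow_one]
    rw [integral_gaussian, ← div_div, div_self Real.pi_ne_zero, one_div, inv_inv,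
      Real.sqrt_sq ha'.le]
  · have he := (InfinitePlace.Completion.isometryEquivComplexOfIsComplex
      (InfinitePlace.not_isReal_iff_isComplex.mp h)).symm.toHomeomorph.measurableEmbedding
    rw [IsometryEquiv.coe_toHomeomorph] at he
    rw [archMeasure, dif_neg h, two_smul, ← two_smul ENNReal, integral_smul_measure,
      he.integral_map]
    simp_rw [norm_isometryEquivComplex_symm, InfinitePlace.mult, if_neg h]
    -- With exponent `-2π|x|²/|a|²` Lebesgue measure on `ℂ` gives `|a|²/2`; the doubling in
    -- `archMeasure` restores `|a|²`.
    rw [GaussianFourier.integral_rexp_neg_mul_sq_norm (by positivity), Complex.finrank_real_complex]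
    simp only [ENNReal.toReal_ofNat, Nat.cast_ofNat, smul_eq_mul]
    rw [div_self two_ne_zero, Real.rpow_one]
    field_simp

/-- The archimedean part of an idele acts on Gaussians by its absolute value. -/
lemma integral_prod_archFactor [GlobalField L] {a : InfiniteAdeleRing L} (ha : ∀ w, a w ≠ 0) :
    Integrable (fun u : InfiniteAdeleRing L => ∏ᶠ w, archFactor w ((a w)⁻¹ * u w))
      (infiniteAdeleMeasure L) ∧
    ∫ u : InfiniteAdeleRing L, ∏ᶠ w, archFactor w ((a w)⁻¹ * u w) ∂(infiniteAdeleMeasure L) =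
      ∏ᶠ w, archAbsVal w (a w) := by
  let _ : Fintype (InfinitePlace L) := Fintype.ofFinite _
  simp_rw [finprod_eq_prod_of_fintype]
  constructor
  · exact Integrable.fintype_prod_dep (μ := fun w : InfinitePlace L => archMeasure w)
      (f := fun w x => archFactor w ((a w)⁻¹ * x)) fun w => (integral_archFactor w (ha w)).1
  · refine (integral_fintype_prod_eq_prod (μ := fun w : InfinitePlace L => archMeasure w)
      (fun w x => archFactor w ((a w)⁻¹ * x))).trans ?_
    exact Finset.prod_congr rfl fun w _ => (integral_archFactor w (ha w)).2

end ArchIntegral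

end AdelicRR

/-! ### The Euler characteristic. -/

namespace AdelicRR

open FinPlace
open scoped Pointwise

section EulerCharacteristic

variable {L : Type*} [Field L]

lemma idele_fst_ne_zero (α : (Adele L)ˣ) (w : InfinitePlace L) : α.val.1 w ≠ 0 := by
  have h : α.val.1 w * α⁻¹.val.1 w = 1 := congrFun (congrArg Prod.fst α.mul_inv) w
  exact left_ne_zero_of_mul_eq_one h

lemma archAbsVal_pos (w : InfinitePlace L) {x : w.Completion} (hx : x ≠ 0) : 0 < archAbsVal w x :=
  pow_pos (norm_pos_iff.mpr hx) _

/-- The finite part of an idele. -/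
def finitePart : (Adele L)ˣ →* (FiniteAdele L)ˣ := Units.map (MonoidHom.snd _ _)

lemma ideleAbs_pos (α : (Adele L)ˣ) : 0 < ideleAbs α :=
  mul_pos (finprod_induction (0 < ·) one_pos (fun _ _ => mul_pos)
    fun w => archAbsVal_pos w (idele_fst_ne_zero α w)) (finprod_absVal_pos (finitePart α))

lemma ideleAbs_one : ideleAbs (1 : (Adele L)ˣ) = 1 := by
  have h1 : ∀ w : InfinitePlace L, archAbsVal w ((1 : (Adele L)ˣ).val.1 w) = 1 := fun w => by
    change ‖(1 : w.Completion)‖ ^ w.mult = 1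
    rw [norm_one, one_pow]
  have h2 : ∀ w : FinPlace L, w.absVal ((1 : (Adele L)ˣ).val.2 w) = 1 := fun w => w.absVal_one
  rw [ideleAbs, finprod_congr h1, finprod_congr h2, finprod_one, finprod_one, one_mul]

lemma integral_finFactor (α : (FiniteAdele L)ˣ) :
    Integrable (fun u : FiniteAdele L => ∏ᶠ w : FinPlace L, finFactor w ((α.val w)⁻¹ * u w))
      (finiteHaar L) ∧
    ∫ u : FiniteAdele L, ∏ᶠ w : FinPlace L, finFactor w ((α.val w)⁻¹ * u w) ∂(finiteHaar L) =
      ∏ᶠ w : FinPlace L, w.absVal (α.val w) := by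
  simp_rw [finprod_finFactor]
  have hm := measurableSet_smul_integral α
  constructor
  · refine (integrable_indicator_iff hm).mpr (integrableOn_const ?_)
    rw [finiteHaar_smul]
    exact ENNReal.coe_ne_top
  · rw [integral_indicator_one hm, measureReal_def, finiteHaar_smul, ← distribHaarChar_finiteIdele]
    rfl

section Relative

variable (K : Type*) [Field K] [Algebra K L] [FiniteDimensional K L] [Algebra.IsSeparable K L]

lemma finprod_discNorm_pos : 0 < ∏ᶠ w : FinPlace L, discNorm K w :=
  finprod_induction (0 < ·) one_pos (fun _ _ => mul_pos) (discNorm_pos K)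

variable [GlobalField K] [GlobalField L]

/-- The integral of `f_α` with respect to the relative measure. -/
theorem integral_eulerFunction (α : (Adele L)ˣ) :
    Integrable (eulerFunction α) (relMeasure K L) ∧
    ∫ u, eulerFunction α u ∂(relMeasure K L) =
      ideleAbs α * (∏ᶠ w : FinPlace L, discNorm K w) ^ (-(1 / 2) : ℝ) := by
  obtain ⟨h1, h2⟩ := integral_prod_archFactor (idele_fst_ne_zero α)
  obtain ⟨h3, h4⟩ := integral_finFactor (finitePart α)
  have hc : 0 ≤ (∏ᶠ w : FinPlace L, discNorm K w) ^ (-(1 / 2) : ℝ) :=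
    Real.rpow_nonneg (finprod_nonneg fun w => (discNorm_pos K w).le) _
  have : SigmaFinite (infiniteAdeleMeasure L) := by
    let _ : Fintype (InfinitePlace L) := Fintype.ofFinite _
    exact inferInstanceAs (SigmaFinite (Measure.pi fun w : InfinitePlace L => archMeasure w))
  rw [relMeasure, finiteRelMeasure_eq]
  set c := (∏ᶠ w : FinPlace L, discNorm K w) ^ (-(1 / 2) : ℝ)
  have : SFinite (ENNReal.ofReal c • finiteHaar L) := inferInstance
  refine ⟨h1.mul_prod (h3.smul_measure ENNReal.ofReal_ne_top), ?_⟩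
  refine (integral_prod_mul (L := ℝ)
    (fun u : InfiniteAdeleRing L => ∏ᶠ w, archFactor w ((α.val.1 w)⁻¹ * u w))
    (fun u : FiniteAdele L => ∏ᶠ w : FinPlace L, finFactor w ((α.val.2 w)⁻¹ * u w))).trans ?_
  rw [h2, integral_smul_measure]
  change _ * ((ENNReal.ofReal c).toReal • ∫ u : FiniteAdele L, ∏ᶠ w : FinPlace L,
    finFactor w (((finitePart α).val w)⁻¹ * u w) ∂(finiteHaar L)) = _
  rw [h4, ENNReal.toReal_ofReal hc, smul_eq_mul, mul_left_comm, mul_comm c]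
  rfl

lemma integral_eulerFunction_pos (α : (Adele L)ˣ) :
    0 < ∫ u, eulerFunction α u ∂(relMeasure K L) := by
  rw [(integral_eulerFunction K α).2]
  exact mul_pos (ideleAbs_pos α) (Real.rpow_pos_of_pos (finprod_discNorm_pos K) _)

/-- The base field enters only through the product of discriminant norms, so comparing base fields
is comparing such products. -/
lemma relEulerChar_eq (α : (Adele L)ˣ) :
    relEulerChar K α =
      Real.log (ideleAbs α) - 1 / 2 * Real.log (∏ᶠ w : FinPlace L, discNorm K w) := by
  have h := finprod_discNorm_pos K (L := L)
  rw [relEulerChar, (integral_eulerFunction K α).2,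
    Real.log_mul (ideleAbs_pos α).ne' (Real.rpow_pos_of_pos h _).ne', Real.log_rpow h]
  ring

end Relative

end EulerCharacteristic

/-- `Q` is an extension of degree one of `ℚ` or `𝔽_p(t)`, so the discriminant results also apply
with base `Q`. -/
lemma globalField_of_ringEquiv {Q : Type*} [Field Q]
    (hQ : Nonempty (Q ≃+* ℚ) ∨ ∃ p : ℕ, p.Prime ∧ Nonempty (Q ≃+* RatFunc (ZMod p))) :
    GlobalField Q := by
  rcases hQ with ⟨⟨e⟩⟩ | ⟨p, hp, ⟨e⟩⟩
  · have : CharZero Q := charZero_of_injective_ringHom (f := e.symm.toRingHom) e.symm.injective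
    have : FiniteDimensional ℚ Q := Module.Finite.of_surjective (Algebra.linearMap ℚ Q) fun x =>
      ⟨e x, (RingHom.congr_fun (Subsingleton.elim (algebraMap ℚ Q) e.symm.toRingHom) (e x)).trans
        (e.symm_apply_apply x)⟩
    exact ⟨Or.inl {}⟩
  · have : Fact p.Prime := ⟨hp⟩
    let _ : Algebra (RatFunc (ZMod p)) Q := e.symm.toRingHom.toAlgebra
    have hs : Function.Surjective (algebraMap (RatFunc (ZMod p)) Q) := e.symm.surjective
    refine ⟨Or.inr ⟨p, this, inferInstance, Module.Finite.of_surjective (Algebra.linearMap _ Q) hs,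
      ⟨fun x => ?_⟩⟩⟩
    obtain ⟨y, rfl⟩ := hs x
    exact isSeparable_algebraMap y

end AdelicRR

end

theorem mainTheorem1 (Q K L : Type*) [Field Q] [Field K] [Field L]
    (hQ : Nonempty (Q ≃+* ℚ) ∨ ∃ p : ℕ, p.Prime ∧ Nonempty (Q ≃+* RatFunc (ZMod p)))
    [Algebra Q K] [Algebra K L] [Algebra Q L] [IsScalarTower Q K L]
    [FiniteDimensional Q K] [Algebra.IsSeparable Q K]
    [FiniteDimensional Q L] [Algebra.IsSeparable Q L] [FiniteDimensional K L]
    [AdelicRR.GlobalField K] [AdelicRR.GlobalField L] :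
    (∃ κ : (AdelicRR.Adele K)ˣ, AdelicRR.IsDiscriminantIdele K L κ) ∧
    ∀ α : (AdelicRR.Adele L)ˣ,
      MeasureTheory.Integrable (AdelicRR.eulerFunction α) (AdelicRR.relMeasure K L) ∧
      0 < ∫ u, AdelicRR.eulerFunction α u ∂(AdelicRR.relMeasure K L) ∧
      (∀ κ : (AdelicRR.Adele K)ˣ, AdelicRR.IsDiscriminantIdele K L κ →
        AdelicRR.relEulerChar K α =
          Real.log (AdelicRR.ideleAbs α) + 1 / 2 * Real.log (AdelicRR.ideleAbs κ)) ∧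
      AdelicRR.relEulerChar K α =
        AdelicRR.relEulerChar Q α -
          Module.finrank K L * AdelicRR.relEulerChar Q (1 : (AdelicRR.Adele K)ˣ) ∧
      AdelicRR.relEulerChar K α - AdelicRR.relEulerChar K (1 : (AdelicRR.Adele L)ˣ) =
        Real.log (AdelicRR.ideleAbs α) := by
  have : AdelicRR.GlobalField Q := AdelicRR.globalField_of_ringEquiv hQ
  have : Algebra.IsSeparable K L := Algebra.isSeparable_tower_top_of_isSeparable Q K L
  refine ⟨AdelicRR.exists_isDiscriminantIdele K, fun α =>
    ⟨(AdelicRR.integral_eulerFunction K α).1, AdelicRR.integral_eulerFunction_pos K α,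
      fun κ hκ => ?_, ?_, ?_⟩⟩
  · rw [AdelicRR.relEulerChar_eq, AdelicRR.ideleAbs_discriminantIdele K hκ, Real.log_inv]
    ring
  · have h1 := (AdelicRR.finprod_discNorm_pos K (L := L)).ne'
    have h2 := (AdelicRR.finprod_discNorm_pos Q (L := K)).ne'
    -- The terms `log |α|` cancel and the trivial idele of `K` contributes only its discriminant
    -- term, so what remains is the logarithm of the tower formula.
    rw [AdelicRR.relEulerChar_eq, AdelicRR.relEulerChar_eq, AdelicRR.relEulerChar_eq,
      AdelicRR.ideleAbs_one, Real.log_one, AdelicRR.finprod_discNorm_tower Q K L,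
      Real.log_mul h1 (pow_ne_zero _ h2), Real.log_pow]
    ring
  · rw [AdelicRR.relEulerChar_eq, AdelicRR.relEulerChar_eq, AdelicRR.ideleAbs_one, Real.log_one]
    ring
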